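/- Let $d\ge 2$ and let $W_i\in\mathbb{R}^{n_i\times n_{i-1}}$, $i=1,\dots,d$, with $n_0=k$. Let $G:\mathbb{R}^k\to\mathbb{R}^{n_d}$ be the network $$G(x)=\operatorname{relu}\bigl(W_d\cdots\operatorname{relu}(W_2\operatorname{relu}(W_1x))\cdots\bigr),\qquad \operatorname{relu}(t)=\max(t,0)\ \text{entrywise},$$ let $A\in\mathbb{R}^{m\times n_d}$, and for $x_0\in\mathbb{R}^k$ put $f(x)=\tfrac12\bigl\||AG(x)|-|AG(x_0)|\bigr\|^2$, with $|\cdot|$ acting entrywise. Let $D_vf(x)=\lim_{t\to0^+}\frac{f(x+tv)-f(x)}{t}$ denote the one-sided directional derivative. Norms are Euclidean for vectors and spectral for matrices, and $\mathcal{B}(x,r)$ is the Euclidean ball. For non-zero $x,y\in\mathbb{R}^n$ let $\hat x=x/\|x\|$, let $\theta_{x,y}=\angle(x,y)$, and let $M_{\hat x\leftrightarrow\hat y}$ be the matrix that sends $\hat x\mapsto\hat y$, $\hat y\mapsto\hat x$, and $z\mapsto0$ for all $z\in\operatorname{span}(\{x,y\})^\perp$. * A matrix $W\in\mathbb{R}^{n\times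 k}$ satisfies the *Weight Distribution Condition* (WDC) with constant $\epsilon$ if for all non-zero $x,y\in\mathbb{R}^k$ $$\Bigl\|W_{+,x}^\top W_{+,y}-\tfrac{\pi-\theta_{x,y}}{2\pi}I_k-\tfrac{\sin\theta_{x,y}}{2\pi}M_{\hat x\leftrightarrow\hat y}\Bigr\|\le\epsilon,\qquad W_{+,x}=\operatorname{diag}(Wx>0)\,W .$$ * $A$ satisfies the *Range Restricted Concentration Property* (RRCP) with constant $\epsilon$ if for all non-zero $x,y\in\mathbb{R}^k$ and all $x_1,x_2,x_3,x_4\in\mathbb{R}^k$ $$\bigl|\bigl\langle (A_{G(x)}^\top A_{G(y)}-\Phi_{G(x),G(y)})(G(x_1)-G(x_2)),\,G(x_3)-G(x_4)\bigr\rangle\bigr|\le 7\epsilon\,\|G(x_1)-G(x_2)\|\,\|G(x_3)-G(x_4)\|,$$ where $A_z=\operatorname{diag}(\operatorname{sgn}(Az))A$ (with $\operatorname{sgn}0=0$) and $\Phi_{z,w}=\frac{\pi-2\theta_{z,w}}{\pi}I_{n_d}+\frac{2\sin\theta_{z,w}}{\pi}M_{\hat z\leftrightarrow\hat w}$. Let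 $g(\theta)=\cos^{-1}\bigl(\frac{(\pi-\theta)\cos\theta+\sin\theta}{\pi}\bigr)$, $\breve\theta_0=\pi$, $\breve\theta_i=g(\breve\theta_{i-1})$, and $$\rho_d=\frac{2\sin\breve\theta_d}{\pi}+\frac{\pi-2\breve\theta_d}{\pi}\sum_{i=0}^{d-1}\frac{\sin\breve\theta_i}{\pi}\prod_{j=i+1}^{d-1}\frac{\pi-\breve\theta_j}{\pi}.$$ **Theorem.** One has $\rho_d>0$ for all $d\ge2$ and $\rho_d\to1$ as $d\to\infty$, and there are universal constants $K_1,K_2>0$ such that the following holds. Let $d\ge2$ and let $\epsilon>0$ satisfy $K_1d^8\epsilon^{1/4}\le1$. Suppose that $W_i$ satisfies the WDC with constant $\epsilon$ for every $i=1,\dots,d$ and that $A$ satisfies the RRCP with constant $\epsilon$. Then for all non-zero $x,x_0\in\mathbb{R}^k$ there exists $v_{x,x_0}\in\mathbb{R}^k$ such that the one-sided directional derivatives of $f$ below exist and satisfy $$D_{-v_{x,x_0}}f(x)<0\quad\text{for all } x\notin\mathcal{B}(x_0,K_2d^3\epsilon^{1/4}\|x_0\|)\cup\mathcal{B}(-\rho_dx_0,K_2d^{14}\epsilon^{1/4}\|x_0\|)\cup\{0\},$$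 $$D_xf(0)<0\quad\text{for all } x\ne0.$$ -/

import Mathlib

noncomputable section

namespace DeepPR

/-- `ℝⁿ` with the Euclidean norm. -/
abbrev E (n : ℕ) : Type := EuclideanSpace ℝ (Fin n)

/-- The normalization `x̂ = x / ‖x‖` (used for non-zero `x`). -/
def hat {n : ℕ} (x : E n) : E n := ‖x‖⁻¹ • x

/-- The operator `M_{x̂ ↔ ŷ}`: the orthogonal projection onto `span {x, y}` followed by the
reflection that exchanges `x̂` and `ŷ`. For non-zero `x`, `y` it is the unique linear map that sends
`x̂ ↦ ŷ`, `ŷ ↦ x̂` and `z ↦ 0` for `z ⊥ span {x, y}`; see `swapMap_hat_left`, `swapMap_hat_right`,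
`swapMap_orthogonal` and `swapMap_unique`. -/
def swapMap {n : ℕ} (x y : E n) : E n →L[ℝ] E n :=
  ((Submodule.span ℝ {hat x - hat y})ᗮ.reflection : E n →L[ℝ] E n) ∘L
    (Submodule.span ℝ {x, y}).starProjection

theorem norm_hat {n : ℕ} {x : E n} (hx : x ≠ 0) : ‖hat x‖ = 1 := by
  have h : ‖x‖ ≠ 0 := norm_ne_zero_iff.mpr hx
  simp [hat, norm_smul, h]

theorem swapMap_hat_left {n : ℕ} {x y : E n} (hx : x ≠ 0) (hy : y ≠ 0) :
    swapMap x y (hat x) = hat y := by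
  have hm : hat x ∈ Submodule.span ℝ {x, y} :=
    Submodule.smul_mem _ _ (Submodule.subset_span (by simp))
  have h : (Submodule.span ℝ {hat x - hat y})ᗮ.reflection (hat x) = hat y :=
    Submodule.reflection_sub ((norm_hat hx).trans (norm_hat hy).symm)
  simpa [swapMap, Submodule.starProjection_eq_self_iff.mpr hm] using h

theorem swapMap_hat_right {n : ℕ} {x y : E n} (hx : x ≠ 0) (hy : y ≠ 0) :
    swapMap x y (hat y) = hat x := by
  have hm : hat y ∈ Submodule.span ℝ {x, y} :=
    Submodule.smul_mem _ _ (Submodule.subset_span (by simp))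
  have h : (Submodule.span ℝ {hat x - hat y})ᗮ.reflection (hat x) = hat y :=
    Submodule.reflection_sub ((norm_hat hx).trans (norm_hat hy).symm)
  have h' : (Submodule.span ℝ {hat x - hat y})ᗮ.reflection (hat y) = hat x := by
    have h2 := Submodule.reflection_reflection (Submodule.span ℝ {hat x - hat y})ᗮ (hat x)
    rwa [h] at h2
  simpa [swapMap, Submodule.starProjection_eq_self_iff.mpr hm] using h'

theorem swapMap_orthogonal {n : ℕ} {x y z : E n} (hz : z ∈ (Submodule.span ℝ {x, y})ᗮ) :
    swapMap x y z = 0 := by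
  have h : (Submodule.span ℝ {x, y}).starProjection z = 0 :=
    (Submodule.starProjection_apply_eq_zero_iff _).mpr hz
  simp [swapMap, h]

theorem swapMap_unique {n : ℕ} {x y : E n} (hx : x ≠ 0) (hy : y ≠ 0) (M : E n →L[ℝ] E n)
    (h₁ : M (hat x) = hat y) (h₂ : M (hat y) = hat x)
    (h₃ : ∀ z ∈ (Submodule.span ℝ {x, y})ᗮ, M z = 0) : M = swapMap x y := by
  have e : ∀ {u : E n}, u ≠ 0 → u = ‖u‖ • hat u := fun {u} hu => by
    simp [hat, smul_smul, norm_ne_zero_iff.mpr hu]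
  have key : ∀ u ∈ Submodule.span ℝ {x, y}, M u = swapMap x y u := by
    intro u hu
    obtain ⟨a, b, rfl⟩ := Submodule.mem_span_pair.mp hu
    rw [e hx, e hy]
    simp only [map_add, map_smul]
    have s1 := swapMap_hat_left hx hy
    have s2 := swapMap_hat_right hx hy
    rw [← e hx, ← e hy, h₁, h₂, s1, s2]
  ext1 u
  have hu : u = (Submodule.span ℝ {x, y}).starProjection u +
      (u - (Submodule.span ℝ {x, y}).starProjection u) := by abel
  have ho : u - (Submodule.span ℝ {x, y}).starProjection u ∈ (Submodule.span ℝ {x, y})ᗮ :=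
    Submodule.sub_starProjection_mem_orthogonal u
  rw [hu, map_add, map_add, h₃ _ ho, swapMap_orthogonal ho,
    key _ (Submodule.starProjection_apply_mem _ u)]

/-- `W_{+,x} = diag(W x > 0) W`. -/
def posRows {n k : ℕ} (W : Matrix (Fin n) (Fin k) ℝ) (x : E k) : Matrix (Fin n) (Fin k) ℝ :=
  Matrix.diagonal (fun i => if 0 < Matrix.toEuclideanLin W x i then (1 : ℝ) else 0) * W

/-- `A_z = diag(sgn(A z)) A`, where `sgn 0 = 0`. -/
def signRows {m n : ℕ} (A : Matrix (Fin m) (Fin n) ℝ) (z : E n) : Matrix (Fin m) (Fin n) ℝ :=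
  Matrix.diagonal (fun i => Real.sign (Matrix.toEuclideanLin A z i)) * A

/-- `Q_{x,y} = ((π - θ) / (2π)) I + (sin θ / (2π)) M_{x̂ ↔ ŷ}` with `θ = ∠(x, y)`. -/
def Q {k : ℕ} (x y : E k) : E k →L[ℝ] E k :=
  ((Real.pi - InnerProductGeometry.angle x y) / (2 * Real.pi)) • ContinuousLinearMap.id ℝ (E k) +
    (Real.sin (InnerProductGeometry.angle x y) / (2 * Real.pi)) • swapMap x y

/-- `Φ_{z,w} = ((π - 2θ) / π) I + (2 sin θ / π) M_{ẑ ↔ ŵ}` with `θ = ∠(z, w)`. -/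
def Phi {n : ℕ} (z w : E n) : E n →L[ℝ] E n :=
  ((Real.pi - 2 * InnerProductGeometry.angle z w) / Real.pi) • ContinuousLinearMap.id ℝ (E n) +
    (2 * Real.sin (InnerProductGeometry.angle z w) / Real.pi) • swapMap z w

/-- The Weight Distribution Condition with constant `ε` (in spectral norm). -/
def WDC {n k : ℕ} (W : Matrix (Fin n) (Fin k) ℝ) (ε : ℝ) : Prop :=
  ∀ x y : E k, x ≠ 0 → y ≠ 0 →
    ‖Matrix.toEuclideanCLM (𝕜 := ℝ) ((posRows W x).transpose * posRows W y) - Q x y‖ ≤ ε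

/-- The Range Restricted Concentration Property of `A` with constant `ε`, relative to the
generative model `G`. -/
def RRCP {k n m : ℕ} (G : E k → E n) (A : Matrix (Fin m) (Fin n) ℝ) (ε : ℝ) : Prop :=
  ∀ x y : E k, x ≠ 0 → y ≠ 0 → ∀ x₁ x₂ x₃ x₄ : E k,
    |inner ℝ
        ((Matrix.toEuclideanCLM (𝕜 := ℝ)
            ((signRows A (G x)).transpose * signRows A (G y)) - Phi (G x) (G y))
          (G x₁ - G x₂))
        (G x₃ - G x₄)| ≤ 7 * ε * ‖G x₁ - G x₂‖ * ‖G x₃ - G x₄‖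

/-- The entrywise `relu`. -/
def relu {n : ℕ} (z : E n) : E n := WithLp.toLp 2 fun i => max (z i) 0

/-- The entrywise absolute value. -/
def absVec {n : ℕ} (z : E n) : E n := WithLp.toLp 2 fun i => |z i|

/-- The depth-`d` network `relu (W_d ⋯ relu (W_2 (relu (W_1 x))) ⋯)`. The layer `W_{i+1}`, of size
`n_{i+1} × n_i`, is the matrix `W i`; only `W 0, …, W (d - 1)` enter. -/
def gen {n : ℕ → ℕ} (W : ∀ i, Matrix (Fin (n (i + 1))) (Fin (n i)) ℝ) :
    ∀ d : ℕ, E (n 0) → E (n d)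
  | 0, x => x
  | d + 1, x => relu (Matrix.toEuclideanLin (W d) (gen W d x))

/-- The empirical risk `f(x) = ½ ‖ |A G(x)| - |A G(x₀)| ‖²`. -/
def risk {k n m : ℕ} (G : E k → E n) (A : Matrix (Fin m) (Fin n) ℝ) (x₀ x : E k) : ℝ :=
  1 / 2 * ‖absVec (Matrix.toEuclideanLin A (G x)) - absVec (Matrix.toEuclideanLin A (G x₀))‖ ^ 2

/-- The one-sided directional derivative `D_v f(x)` exists and equals `D`. -/
def HasOneSidedDeriv {k : ℕ} (f : E k → ℝ) (x v : E k) (D : ℝ) : Prop :=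
  Filter.Tendsto (fun t : ℝ => (f (x + t • v) - f x) / t) (nhdsWithin 0 (Set.Ioi 0)) (nhds D)

/-- `g(θ) = arccos ((cos θ (π - θ) + sin θ) / π)`. -/
def g (θ : ℝ) : ℝ :=
  Real.arccos ((Real.cos θ * (Real.pi - θ) + Real.sin θ) / Real.pi)

/-- The angles `θ̆₀ = π`, `θ̆ᵢ₊₁ = g(θ̆ᵢ)`. -/
def breve (i : ℕ) : ℝ := g^[i] Real.pi

/-- `ρ_d = 2 sin θ̆_d / π + ((π - 2 θ̆_d) / π) ∑_{i<d} (sin θ̆ᵢ / π) ∏_{i<j<d} (π - θ̆ⱼ) / π`. -/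
def rho (d : ℕ) : ℝ :=
  2 * Real.sin (breve d) / Real.pi +
    (Real.pi - 2 * breve d) / Real.pi *
      ∑ i ∈ Finset.range d, Real.sin (breve i) / Real.pi *
        ∏ j ∈ Finset.Ico (i + 1) d, (Real.pi - breve j) / Real.pi

end DeepPR

end

noncomputable section

namespace DeepPR

open Real Set Filter Topology InnerProductGeometry

/-! The proof is by contraposition: a non-zero `x` at which every one-sided derivative of the risk
is non-negative lies within `ε ^ (1/4) / 2 * ‖x₀‖` of `x₀` or of `-ρ_d x₀`.

Along a ray `x + t v` with small `t > 0` all activation patterns and signs are constant, so `G (x +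
t v) = G x + t L v` with a linear `L` (`genDir`, `eventually_gen_eq`), and the risk is a quadratic
polynomial in `t` there. By the RRCP its derivative is, up to `O(ε)`, `⟨G x - Φ G x₀, L v⟩`
(`exists_hasOneSidedDeriv_risk_le`). The WDC, applied layer by layer, evaluates such inner products:
`L` scales by about `2 ^ (-d/2)`, and the angles `θᵢ` between the layer outputs of `x` and `x₀`
nearly follow `cos θᵢ₊₁ = cosStep θᵢ`.

Three directions suffice. The choices `v = x` and `v = -x` force `‖x‖ ≈ phaseFactor θ_d * ‖x₀‖`
(`abs_norm_sub_le_of_not_descent`). The choice `v = e`, the component of `x₀` orthogonal to `x`, has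
derivative at most a negative multiple of `(π - 2 θ_d) * ∏ (π - θᵢ) / π * ‖e‖²` plus an error. Two
layers bring the angle below `π / 2`, and the angles decay like `1 / i`, so the product is at least
`(π - θ₀) / π * d ^ (-12)`. Hence `(π - θ₀) sin θ₀` is small
(`pi_sub_angle_mul_sin_le_of_not_descent`), and `θ₀` is close to `0` or `π`.

The angle recursion is `1`-Lipschitz in the cosine, so its orbit stays close to the exact orbit from
`0` or from `π`. The former is constant and gives `‖x‖ ≈ ‖x₀‖`. The latter is `breve`, and
`phaseFactor (breve d) = rho d` (`rho_eq_phaseFactor`) gives `‖x‖ ≈ ρ_d ‖x₀‖`. The same formula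
yields positivity and the limit of `ρ_d`. -/

/-! ### One-variable estimates for `cosStep` and `phaseFactor`. -/

/-- The cosine of `g θ`, before taking `arccos`. -/
def cosStep (θ : ℝ) : ℝ := (cos θ * (π - θ) + sin θ) / π

/-- The factor `((π - 2θ) cos θ + 2 sin θ) / π`, so that
`⟨Φ_{z,w} w, z⟩ = ‖z‖ ‖w‖ phaseFactor (∠(z, w))`. -/
def phaseFactor (θ : ℝ) : ℝ := ((π - 2 * θ) * cos θ + 2 * sin θ) / π

theorem hasDerivAt_cosStep (θ : ℝ) : HasDerivAt cosStep (-(π - θ) * sin θ / π) θ := by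
  have h := (((hasDerivAt_cos θ).mul ((hasDerivAt_id θ).const_sub π)).add
    (hasDerivAt_sin θ)).div_const π
  refine HasDerivAt.congr_deriv h ?_
  simp only [id]
  ring

theorem hasDerivAt_phaseFactor (θ : ℝ) :
    HasDerivAt phaseFactor (-(π - 2 * θ) * sin θ / π) θ := by
  have h := (((((hasDerivAt_id θ).const_mul 2).const_sub π).mul (hasDerivAt_cos θ)).add
    ((hasDerivAt_sin θ).const_mul 2)).div_const π
  refine HasDerivAt.congr_deriv h ?_
  simp only [id]
  ring

/-- If `|u'| ≤ sin` on `[0, π]`, then `u` is there a `1`-Lipschitz function of the cosine. -/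
theorem abs_sub_le_abs_cos_sub {u u' : ℝ → ℝ} (hu : ∀ θ, HasDerivAt u (u' θ) θ)
    (h : ∀ θ ∈ Icc 0 π, |u' θ| ≤ sin θ) {a b : ℝ} (ha : a ∈ Icc 0 π) (hb : b ∈ Icc 0 π) :
    |u a - u b| ≤ |cos a - cos b| := by
  have hsub : MonotoneOn (fun θ => u θ - cos θ) (Icc 0 π) := by
    refine monotoneOn_of_hasDerivWithinAt_nonneg (f' := fun θ => u' θ - -sin θ) (convex_Icc 0 π)
      (fun θ _ => ((hu θ).sub (hasDerivAt_cos θ)).continuousAt.continuousWithinAt)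
      (fun θ _ => ((hu θ).sub (hasDerivAt_cos θ)).hasDerivWithinAt) fun θ hθ => ?_
    have := (abs_le.mp (h θ (interior_subset hθ))).1
    linarith
  have hadd : AntitoneOn (fun θ => u θ + cos θ) (Icc 0 π) := by
    refine antitoneOn_of_hasDerivWithinAt_nonpos (f' := fun θ => u' θ + -sin θ) (convex_Icc 0 π)
      (fun θ _ => ((hu θ).add (hasDerivAt_cos θ)).continuousAt.continuousWithinAt)
      (fun θ _ => ((hu θ).add (hasDerivAt_cos θ)).hasDerivWithinAt) fun θ hθ => ?_
    have := (abs_le.mp (h θ (interior_subset hθ))).2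
    linarith
  have key : ∀ a ∈ Icc 0 π, ∀ b ∈ Icc 0 π, a ≤ b → |u a - u b| ≤ cos a - cos b := by
    intro a ha b hb hab
    have h1 := hsub ha hb hab
    have h2 := hadd ha hb hab
    simp only at h1 h2
    rw [abs_le]
    constructor <;> linarith
  rcases le_total a b with hab | hab
  · exact (key a ha b hb hab).trans (le_abs_self _)
  · rw [abs_sub_comm, abs_sub_comm (cos a)]
    exact (key b hb a ha hab).trans (le_abs_self _)

/-- The slope with respect to the cosine is `(π - θ) / π ∈ [0, 1]`. This is why errors made in
successive layers add up instead of being amplified. -/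
theorem abs_cosStep_sub_le {a b : ℝ} (ha : a ∈ Icc 0 π) (hb : b ∈ Icc 0 π) :
    |cosStep a - cosStep b| ≤ |cos a - cos b| := by
  refine abs_sub_le_abs_cos_sub hasDerivAt_cosStep (fun θ hθ => ?_) ha hb
  have hs := sin_nonneg_of_mem_Icc hθ
  have hp := pi_pos
  rw [abs_le, le_div_iff₀ hp, div_le_iff₀ hp]
  constructor <;> nlinarith [hθ.1, hθ.2, mul_nonneg hθ.1 hs, mul_nonneg (sub_nonneg.2 hθ.2) hs]

theorem abs_phaseFactor_sub_le {a b : ℝ} (ha : a ∈ Icc 0 π) (hb : b ∈ Icc 0 π) :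
    |phaseFactor a - phaseFactor b| ≤ |cos a - cos b| := by
  refine abs_sub_le_abs_cos_sub hasDerivAt_phaseFactor (fun θ hθ => ?_) ha hb
  have hs := sin_nonneg_of_mem_Icc hθ
  have hp := pi_pos
  rw [abs_le, le_div_iff₀ hp, div_le_iff₀ hp]
  constructor <;> nlinarith [hθ.1, hθ.2, mul_nonneg hθ.1 hs, mul_nonneg (sub_nonneg.2 hθ.2) hs]

theorem antitoneOn_cosStep : AntitoneOn cosStep (Icc 0 π) := by
  refine antitoneOn_of_hasDerivWithinAt_nonpos (f' := fun θ => -(π - θ) * sin θ / π)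
    (convex_Icc 0 π) (fun θ _ => (hasDerivAt_cosStep θ).continuousAt.continuousWithinAt)
    (fun θ _ => (hasDerivAt_cosStep θ).hasDerivWithinAt) fun θ hθ => ?_
  have hθ' := interior_subset hθ
  have := mul_nonneg (sub_nonneg.2 hθ'.2) (sin_nonneg_of_mem_Icc hθ')
  exact div_nonpos_of_nonpos_of_nonneg (by linarith) pi_pos.le

theorem cosStep_zero : cosStep 0 = 1 := by
  simp [cosStep, pi_ne_zero]

theorem cosStep_pi : cosStep π = 0 := by
  simp [cosStep]

theorem cosStep_pi_div_two : cosStep (π / 2) = 1 / π := by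
  simp [cosStep]

theorem cosStep_mem {θ : ℝ} (hθ : θ ∈ Icc 0 π) : cosStep θ ∈ Icc 0 1 := by
  have h0 : (0 : ℝ) ∈ Icc 0 π := ⟨le_rfl, pi_pos.le⟩
  have hπ : π ∈ Icc 0 π := ⟨pi_pos.le, le_rfl⟩
  constructor
  · simpa [cosStep_pi] using antitoneOn_cosStep hθ hπ hθ.2
  · simpa [cosStep_zero] using antitoneOn_cosStep h0 hθ hθ.1

theorem phaseFactor_zero : phaseFactor 0 = 1 := by
  simp [phaseFactor, pi_ne_zero]

/-- Since `|cos θ| ≤ |π / 2 - θ|` with equal signs, the numerator is at least `2 cos² θ + 2 sin θ =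
2 + 2 sin θ (1 - sin θ)`. -/
theorem two_div_pi_le_phaseFactor {θ : ℝ} (hθ : θ ∈ Icc 0 π) : 2 / π ≤ phaseFactor θ := by
  have hs := sin_nonneg_of_mem_Icc hθ
  have hs1 := sin_le_one θ
  have hsc := sin_sq_add_cos_sq θ
  unfold phaseFactor
  gcongr
  rcases le_total θ (π / 2) with h | h
  · have h1 : cos θ ≤ π / 2 - θ := by
      rw [← sin_pi_div_two_sub]
      exact sin_le (by linarith)
    have h2 : 0 ≤ cos θ := cos_nonneg_of_mem_Icc ⟨by linarith [hθ.1, pi_pos], h⟩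
    nlinarith [mul_le_mul_of_nonneg_right h1 h2]
  · have h1 : -cos θ ≤ θ - π / 2 := by
      rw [← sin_sub_pi_div_two]
      exact sin_le (by linarith)
    have h2 : cos θ ≤ 0 := cos_nonpos_of_pi_div_two_le_of_le h (by linarith [hθ.2])
    nlinarith [mul_le_mul_of_nonneg_right h1 (neg_nonneg.2 h2)]

theorem phaseFactor_le_two {θ : ℝ} (hθ : θ ∈ Icc 0 π) : phaseFactor θ ≤ 2 := by
  have hp := pi_gt_three
  unfold phaseFactor
  rw [div_le_iff₀ pi_pos]
  have h1 : (π - 2 * θ) * cos θ ≤ π := by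
    calc (π - 2 * θ) * cos θ ≤ |(π - 2 * θ) * cos θ| := le_abs_self _
      _ = |π - 2 * θ| * |cos θ| := abs_mul _ _
      _ ≤ π * 1 := by
        gcongr
        · exact abs_le.2 ⟨by linarith [hθ.2], by linarith [hθ.1]⟩
        · exact abs_cos_le_one θ
      _ = π := mul_one π
  linarith [sin_le_one θ]

/-! ### Decay and stability of the angle recursion. -/

/-- Both sides vanish at `0`, and with `s = sin (θ / 2)`, `c = cos (θ / 2)` the derivative of the
difference is `s c (2 θ - (3 π / 4) s) ≥ 0`. The right side is `π` times the gain of the cosine in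
one layer. -/
theorem pi_div_two_mul_sin_half_pow_le {θ : ℝ} (hθ : θ ∈ Icc 0 π) :
    π / 2 * sin (θ / 2) ^ 3 ≤ sin θ - θ * cos θ := by
  have hd : ∀ t : ℝ, HasDerivAt (fun t => sin t - t * cos t - π / 2 * sin (t / 2) ^ 3)
      (t * sin t - 3 * π / 4 * (sin (t / 2) ^ 2 * cos (t / 2))) t := by
    intro t
    have h1 := ((hasDerivAt_id t).div_const 2).sin
    have h := ((hasDerivAt_sin t).sub ((hasDerivAt_id t).mul (hasDerivAt_cos t))).sub
      ((h1.pow 3).const_mul (π / 2))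
    refine HasDerivAt.congr_deriv h ?_
    simp only [id]
    push_cast
    ring
  have hm : MonotoneOn (fun t => sin t - t * cos t - π / 2 * sin (t / 2) ^ 3) (Icc 0 π) := by
    refine monotoneOn_of_hasDerivWithinAt_nonneg (convex_Icc 0 π)
      (fun t _ => (hd t).continuousAt.continuousWithinAt)
      (fun t _ => (hd t).hasDerivWithinAt) fun t ht => ?_
    have ht' := interior_subset ht
    have h1 : sin (t / 2) ≤ t / 2 := sin_le (by linarith [ht'.1])
    have h2 : 0 ≤ sin (t / 2) :=
      sin_nonneg_of_nonneg_of_le_pi (by linarith [ht'.1]) (by linarith [ht'.2, pi_pos])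
    have h3 : 0 ≤ cos (t / 2) :=
      cos_nonneg_of_mem_Icc ⟨by linarith [ht'.1, pi_pos], by linarith [ht'.2]⟩
    have h4 : sin t = 2 * sin (t / 2) * cos (t / 2) := by
      rw [← sin_two_mul]
      ring_nf
    have h5 : 0 ≤ 2 * t - 3 * π / 4 * sin (t / 2) := by
      nlinarith [pi_le_four, pi_pos, ht'.1]
    have h6 := mul_nonneg (mul_nonneg h2 h3) h5
    rw [h4]
    linarith
  have := hm ⟨le_rfl, pi_pos.le⟩ hθ hθ.1
  simp at this
  linarith

theorem sin_half_sq_eq (θ : ℝ) : sin (θ / 2) ^ 2 = (1 - cos θ) / 2 := by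
  rw [sin_sq_eq_half_sub, mul_div_cancel₀ θ two_ne_zero]
  ring

theorem sin_half_nonneg {θ : ℝ} (hθ : θ ∈ Icc 0 π) : 0 ≤ sin (θ / 2) :=
  sin_nonneg_of_nonneg_of_le_pi (by linarith [hθ.1]) (by linarith [hθ.2, pi_pos])

/-- The one-step contraction behind the decay of the angles. -/
theorem one_sub_cosStep_half_le {θ : ℝ} (hθ : θ ∈ Icc 0 π) :
    (1 - cosStep θ) / 2 ≤ sin (θ / 2) ^ 2 - sin (θ / 2) ^ 3 / 4 := by
  have h := pi_div_two_mul_sin_half_pow_le hθ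
  have hc : cosStep θ = cos θ + (sin θ - θ * cos θ) / π := by
    unfold cosStep
    field_simp
    ring
  have h2 : sin (θ / 2) ^ 3 / 2 ≤ (sin θ - θ * cos θ) / π := by
    rw [le_div_iff₀ pi_pos]
    linarith
  rw [sin_half_sq_eq, hc]
  linarith

/-- Angles that follow the recursion `cos θᵢ₊₁ ≥ cosStep θᵢ` up to a small error decay like
`1 / i`. -/
theorem sin_half_le_of_cosStep_le {θ : ℕ → ℝ} {δ : ℝ} {d : ℕ} (hθ : ∀ i, θ i ∈ Icc 0 π)
    (hstep : ∀ i < d, cosStep (θ i) - δ ≤ cos (θ (i + 1))) (hδ : δ * (d + 12) ^ 3 ≤ 288) :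
    ∀ i ≤ d, sin (θ i / 2) ≤ 12 / (i + 12) := by
  intro i
  induction i with
  | zero =>
    intro _
    simpa using sin_le_one (θ 0 / 2)
  | succ i ih =>
    intro hi
    have ih := ih (by omega)
    set s := sin (θ i / 2) with hs
    set w : ℝ := 12 / (i + 12) with hw
    set w' : ℝ := 12 / ((i + 1 : ℕ) + 12) with hw'
    have hi0 : (0 : ℝ) ≤ i := i.cast_nonneg
    have hw0 : 0 < w := by positivity
    have hw'0 : 0 < w' := by positivity
    have hw1 : w ≤ 1 := by
      rw [hw, div_le_one (by positivity)]
      linarith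
    have hs0 : 0 ≤ s := sin_half_nonneg (hθ i)
    have h1 : sin (θ (i + 1) / 2) ^ 2 ≤ s ^ 2 - s ^ 3 / 4 + δ / 2 := by
      have := hstep i (by omega)
      have h2 := one_sub_cosStep_half_le (hθ i)
      rw [sin_half_sq_eq]
      linarith
    -- The map `s ↦ s² - s³ / 4` is increasing on `[0, 1]`, so the bound on `s` may be inserted.
    have h2 : s ^ 2 - s ^ 3 / 4 ≤ w ^ 2 - w ^ 3 / 4 := by
      have : 0 ≤ (w - s) * (w + s - (w ^ 2 + w * s + s ^ 2) / 4) := by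
        refine mul_nonneg (by linarith) ?_
        nlinarith
      nlinarith
    have hww' : w - w' = w * w' / 12 := by
      rw [hw, hw']
      push_cast
      field_simp
      ring
    have hle : w' ≤ w := by
      have := mul_pos hw0 hw'0
      linarith
    have h3 : w ^ 2 - w' ^ 2 ≤ w ^ 3 / 6 := by
      have e : w ^ 2 - w' ^ 2 = w * w' / 12 * (w + w') := by
        rw [← hww']
        ring
      have : w * w' / 12 * (w + w') ≤ w * w / 12 * (w + w) := by gcongr
      rw [e]
      linarith
    -- The recursion gains `w³ / 4`, while passing from `w²` to `w'²` costs at most `w³ / 6`. The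
    -- remaining `w³ / 12` must absorb `δ / 2`, and `w³ / 6 = 288 / (i + 12)³`.
    have h4 : δ ≤ w ^ 3 / 6 := by
      have hid : (i : ℝ) + 12 ≤ d + 12 := by
        have : (i : ℝ) ≤ d := by exact_mod_cast (by omega : i ≤ d)
        linarith
      have : w ^ 3 / 6 = 288 / (i + 12) ^ 3 := by
        rw [hw]
        field_simp
        norm_num
      rw [this, le_div_iff₀ (by positivity)]
      rcases le_total δ 0 with h | h
      · exact (mul_nonpos_of_nonpos_of_nonneg h (by positivity)).trans (by norm_num)
      · exact (mul_le_mul_of_nonneg_left (by gcongr) h).trans hδ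
    exact (abs_le_of_sq_le_sq' (by linarith) hw'0.le).2

theorem div_pi_le_sin_half {θ : ℝ} (hθ : θ ∈ Icc 0 π) : θ / π ≤ sin (θ / 2) := by
  have h := mul_le_sin (x := θ / 2) (by linarith [hθ.1]) (by linarith [hθ.2])
  calc θ / π = 2 / π * (θ / 2) := by ring
    _ ≤ _ := h

/-- A polynomial lower bound for `∏ (π - θᵢ) / π` along decaying angles. -/
theorem prod_one_sub_angle_ge {θ : ℕ → ℝ} {d : ℕ} (hθ : ∀ i, θ i ∈ Icc 0 π)
    (h : ∀ i ≤ d, sin (θ i / 2) ≤ 12 / (i + 12)) (j : ℕ) (hj : j + 1 ≤ d) :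
    (π - θ 0) / π * (1 / (j + 1 : ℝ) ^ 12) ≤ ∏ i ∈ Finset.range (j + 1), (π - θ i) / π := by
  induction j with
  | zero => simp
  | succ j ih =>
    have ih := ih (by omega)
    rw [Finset.prod_range_succ]
    have hp : ((j : ℝ) + 1) / (j + 1 + 12) ≤ (π - θ (j + 1)) / π := by
      have h1 := (div_pi_le_sin_half (hθ (j + 1))).trans (h (j + 1) (by omega))
      have e1 : (π - θ (j + 1)) / π = 1 - θ (j + 1) / π := by
        field_simp
      have e2 : ((j : ℝ) + 1) / (j + 1 + 12) = 1 - 12 / (j + 1 + 12) := by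
        field_simp
        ring
      rw [e1, e2]
      push_cast at h1
      linarith
    -- Bernoulli's inequality; the left sides telescope to the power `-12`.
    have hb : (((j : ℝ) + 1) / (j + 2)) ^ 12 ≤ (j + 1) / (j + 1 + 12) := by
      have hb1 := one_add_mul_le_pow (a := 1 / ((j : ℝ) + 1))
        (by linarith [show 0 ≤ 1 / ((j : ℝ) + 1) by positivity]) 12
      have e1 : ((j : ℝ) + 1) / (j + 1 + 12) = (1 + (12 : ℕ) * (1 / ((j : ℝ) + 1)))⁻¹ := by
        push_cast
        field_simp
      have e2 : (((j : ℝ) + 1) / (j + 2)) ^ 12 = ((1 + 1 / ((j : ℝ) + 1)) ^ 12)⁻¹ := by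
        rw [← inv_pow]
        congr 1
        field_simp
        ring
      rw [e1, e2]
      gcongr
    have h0 : 0 ≤ (π - θ 0) / π := div_nonneg (by linarith [(hθ 0).2]) pi_pos.le
    calc (π - θ 0) / π * (1 / (((j + 1 : ℕ) : ℝ) + 1) ^ 12)
        = ((π - θ 0) / π * (1 / (j + 1 : ℝ) ^ 12)) * (((j : ℝ) + 1) / (j + 2)) ^ 12 := by
          push_cast
          field_simp
          ring
      _ ≤ _ := by
        refine mul_le_mul ih (hb.trans hp) (by positivity) ?_
        exact Finset.prod_nonneg fun i _ => div_nonneg (by linarith [(hθ i).2]) pi_pos.le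

theorem g_mem (θ : ℝ) : g θ ∈ Icc 0 π := ⟨arccos_nonneg _, arccos_le_pi _⟩

theorem cos_g {θ : ℝ} (hθ : θ ∈ Icc 0 π) : cos (g θ) = cosStep θ := by
  have h := cosStep_mem hθ
  exact cos_arccos (by have := h.1; unfold cosStep at this; linarith) h.2

theorem iterate_g_mem {ψ : ℝ} (hψ : ψ ∈ Icc 0 π) (i : ℕ) : g^[i] ψ ∈ Icc 0 π := by
  cases i with
  | zero => exact hψ
  | succ i =>
    rw [Function.iterate_succ_apply']
    exact g_mem _

theorem g_zero : g 0 = 0 := by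
  have := cosStep_zero
  unfold cosStep at this
  rw [g, this, arccos_one]

/-- Approximate orbits of the angle recursion stay close, in cosine, to exact orbits. -/
theorem abs_cos_sub_cos_iterate_le {θ : ℕ → ℝ} {δ : ℝ} {d : ℕ} (hθ : ∀ i, θ i ∈ Icc 0 π)
    (hstep : ∀ i < d, |cos (θ (i + 1)) - cosStep (θ i)| ≤ δ) {ψ : ℝ} (hψ : ψ ∈ Icc 0 π) :
    ∀ i ≤ d, |cos (θ i) - cos (g^[i] ψ)| ≤ |cos (θ 0) - cos ψ| + i * δ := by
  intro i
  induction i with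
  | zero => intro _; simp
  | succ i ih =>
    intro hi
    rw [Function.iterate_succ_apply', cos_g (iterate_g_mem hψ i)]
    have h1 := hstep i (by omega)
    have h2 := abs_cosStep_sub_le (hθ i) (iterate_g_mem hψ i)
    have h3 := ih (by omega)
    have h4 := abs_sub_le (cos (θ (i + 1))) (cosStep (θ i)) (cosStep (g^[i] ψ))
    push_cast
    linarith

/-! ### The constant `rho d`. -/

theorem breve_mem (i : ℕ) : breve i ∈ Icc 0 π := iterate_g_mem ⟨pi_pos.le, le_rfl⟩ i

theorem cos_breve_succ (i : ℕ) : cos (breve (i + 1)) = cosStep (breve i) := by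
  have h := cos_g (breve_mem i)
  unfold breve at *
  rwa [Function.iterate_succ_apply']

/-- The recursion `cos θ̆_{d+1} = ((π - θ̆_d) / π) cos θ̆_d + sin θ̆_d / π` is affine. The sum
satisfies it too, so its difference from the cosine solves the homogeneous recursion, with initial
value `1`. -/
theorem sum_breve_eq (d : ℕ) :
    ∑ i ∈ Finset.range d, sin (breve i) / π * ∏ j ∈ Finset.Ico (i + 1) d, (π - breve j) / π =
      cos (breve d) + ∏ j ∈ Finset.range d, (π - breve j) / π := by
  induction d with
  | zero => simp [breve]
  | succ d ih =>
    rw [Finset.sum_range_succ, Finset.prod_range_succ, cos_breve_succ]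
    have : ∑ i ∈ Finset.range d, sin (breve i) / π *
          ∏ j ∈ Finset.Ico (i + 1) (d + 1), (π - breve j) / π =
        (∑ i ∈ Finset.range d, sin (breve i) / π *
          ∏ j ∈ Finset.Ico (i + 1) d, (π - breve j) / π) * ((π - breve d) / π) := by
      rw [Finset.sum_mul]
      refine Finset.sum_congr rfl fun i hi => ?_
      rw [Finset.prod_Ico_succ_top (by have := Finset.mem_range.1 hi; omega)]
      ring
    rw [this, ih]
    simp only [cosStep, Finset.Ico_self, Finset.prod_empty]
    ring

theorem rho_eq_phaseFactor {d : ℕ} (hd : 1 ≤ d) : rho d = phaseFactor (breve d) := by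
  -- The factor at `j = 0` vanishes because `breve 0 = π`.
  have h0 : ∏ j ∈ Finset.range d, (π - breve j) / π = 0 :=
    Finset.prod_eq_zero (i := 0) (by simp; omega) (by simp [breve])
  rw [rho, sum_breve_eq, h0, phaseFactor]
  ring

theorem rho_pos {d : ℕ} (hd : 1 ≤ d) : 0 < rho d := by
  rw [rho_eq_phaseFactor hd]
  exact (by positivity : 0 < 2 / π).trans_le (two_div_pi_le_phaseFactor (breve_mem d))

theorem sin_half_breve_le (d : ℕ) : sin (breve d / 2) ≤ 12 / (d + 12) :=
  sin_half_le_of_cosStep_le (δ := 0) (d := d) breve_mem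
    (fun i _ => by rw [cos_breve_succ, sub_zero]) (by simp) d le_rfl

theorem abs_rho_sub_one_le {d : ℕ} (hd : 1 ≤ d) : |rho d - 1| ≤ 2 * (12 / (d + 12)) ^ 2 := by
  have h0 : (0 : ℝ) ∈ Icc 0 π := ⟨le_rfl, pi_pos.le⟩
  have h := abs_phaseFactor_sub_le (breve_mem d) h0
  rw [phaseFactor_zero, ← rho_eq_phaseFactor hd, cos_zero] at h
  refine h.trans ?_
  rw [abs_of_nonpos (by linarith [cos_le_one (breve d)])]
  have h1 := sin_half_sq_eq (breve d)
  have h2 := pow_le_pow_left₀ (sin_half_nonneg (breve_mem d)) (sin_half_breve_le d) 2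
  linarith

theorem tendsto_rho : Tendsto rho atTop (𝓝 1) := by
  rw [tendsto_iff_dist_tendsto_zero]
  have h1 : Tendsto (fun d : ℕ => 2 * (12 / ((d : ℝ) + 12)) ^ 2) atTop (𝓝 0) := by
    have : Tendsto (fun d : ℕ => 12 / ((d : ℝ) + 12)) atTop (𝓝 0) :=
      tendsto_const_nhds.div_atTop
        (tendsto_atTop_add_const_right _ _ tendsto_natCast_atTop_atTop)
    simpa using (this.pow 2).const_mul 2
  refine squeeze_zero' (Eventually.of_forall fun _ => dist_nonneg) ?_ h1
  filter_upwards [eventually_ge_atTop 1] with d hd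
  exact abs_rho_sub_one_le hd

/-! ### Activation patterns as matrices, and homogeneity of the network. -/

theorem inner_toEuclideanCLM_transpose_mul {m k : ℕ} (B C : Matrix (Fin m) (Fin k) ℝ)
    (u v : E k) :
    inner ℝ (Matrix.toEuclideanCLM (𝕜 := ℝ) (B.transpose * C) u) v =
      inner ℝ (Matrix.toEuclideanLin C u) (Matrix.toEuclideanLin B v) := by
  have h1 : Matrix.toEuclideanCLM (𝕜 := ℝ) (B.transpose * C) u =
      (Matrix.toEuclideanLin B).adjoint (Matrix.toEuclideanLin C u) := by
    rw [← Matrix.toEuclideanLin_conjTranspose_eq_adjoint,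
      Matrix.conjTranspose_eq_transpose_of_trivial]
    ext i
    simp [Matrix.toLpLin_apply, Matrix.mulVec_mulVec]
  rw [h1, LinearMap.adjoint_inner_left]

theorem toEuclideanLin_diagonal_mul_apply {m k : ℕ} (s : Fin m → ℝ)
    (B : Matrix (Fin m) (Fin k) ℝ) (u : E k) (i : Fin m) :
    Matrix.toEuclideanLin (Matrix.diagonal s * B) u i = s i * Matrix.toEuclideanLin B u i := by
  simp only [Matrix.toLpLin_apply]
  rw [← Matrix.mulVec_mulVec, Matrix.mulVec_diagonal]

theorem sign_mul_eq_abs (a : ℝ) : Real.sign a * a = |a| := by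
  rcases lt_trichotomy a 0 with h | rfl | h
  · rw [Real.sign_of_neg h, abs_of_neg h, neg_one_mul]
  · simp
  · rw [Real.sign_of_pos h, abs_of_pos h, one_mul]

theorem relu_eq_posRows {n k : ℕ} (W : Matrix (Fin n) (Fin k) ℝ) (x : E k) :
    relu (Matrix.toEuclideanLin W x) = Matrix.toEuclideanLin (posRows W x) x := by
  ext i
  rw [posRows, toEuclideanLin_diagonal_mul_apply]
  simp only [relu]
  split_ifs with h
  · rw [max_eq_left h.le, one_mul]
  · rw [max_eq_right (not_lt.1 h), zero_mul]

theorem absVec_eq_signRows {m n : ℕ} (A : Matrix (Fin m) (Fin n) ℝ) (z : E n) :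
    absVec (Matrix.toEuclideanLin A z) = Matrix.toEuclideanLin (signRows A z) z := by
  ext i
  rw [signRows, toEuclideanLin_diagonal_mul_apply]
  exact (sign_mul_eq_abs _).symm

theorem gen_succ_eq_posRows {n : ℕ → ℕ} (W : ∀ i, Matrix (Fin (n (i + 1))) (Fin (n i)) ℝ)
    (i : ℕ) (x : E (n 0)) :
    gen W (i + 1) x = Matrix.toEuclideanLin (posRows (W i) (gen W i x)) (gen W i x) :=
  relu_eq_posRows _ _

theorem gen_smul {n : ℕ → ℕ} (W : ∀ i, Matrix (Fin (n (i + 1))) (Fin (n i)) ℝ) (i : ℕ)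
    (x : E (n 0)) {t : ℝ} (ht : 0 ≤ t) : gen W i (t • x) = t • gen W i x := by
  induction i with
  | zero => rfl
  | succ i ih =>
    ext j
    simp only [gen, ih, map_smul, relu, PiLp.smul_apply, smul_eq_mul]
    rw [mul_max_of_nonneg _ _ ht, mul_zero]

theorem gen_zero_right {n : ℕ → ℕ} (W : ∀ i, Matrix (Fin (n (i + 1))) (Fin (n i)) ℝ) (i : ℕ) :
    gen W i 0 = 0 := by
  simpa using gen_smul W i 0 (le_refl (0 : ℝ))

/-! ### One-sided limits of activation patterns -/

theorem tendsto_add_smul_nhdsGT_zero {V : Type*} [NormedAddCommGroup V] [NormedSpace ℝ V]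
    (u w : V) : Tendsto (fun t : ℝ => u + t • w) (𝓝[>] 0) (𝓝 u) := by
  have h : Continuous fun t : ℝ => u + t • w := by fun_prop
  have := h.tendsto 0
  rw [zero_smul, add_zero] at this
  exact this.mono_left nhdsWithin_le_nhds

theorem eventually_pos_add_mul_iff (a b : ℝ) :
    ∀ᶠ t in 𝓝[>] (0 : ℝ), (0 < a + t * b ↔ 0 < a ∨ a = 0 ∧ 0 < b) := by
  have ht := tendsto_add_smul_nhdsGT_zero a b
  simp only [smul_eq_mul] at ht
  rcases lt_trichotomy a 0 with h | h | h
  · filter_upwards [ht.eventually (gt_mem_nhds h)] with t h1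
    constructor
    · intro h2; linarith
    · rintro (h2 | ⟨h2, -⟩) <;> linarith
  · filter_upwards [self_mem_nhdsWithin] with t h1
    simp [h, mul_pos_iff_of_pos_left (mem_Ioi.1 h1)]
  · filter_upwards [ht.eventually (lt_mem_nhds h)] with t h1
    simp [h, h1]

theorem eventually_sign_add_mul_eq (a b : ℝ) :
    ∀ᶠ t in 𝓝[>] (0 : ℝ), Real.sign (a + t * b) =
      if a = 0 then Real.sign b else Real.sign a := by
  have ht := tendsto_add_smul_nhdsGT_zero a b
  simp only [smul_eq_mul] at ht
  rcases lt_trichotomy a 0 with h | h | h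
  · filter_upwards [ht.eventually (gt_mem_nhds h)] with t h1
    rw [if_neg h.ne, Real.sign_of_neg h1, Real.sign_of_neg h]
  · filter_upwards [self_mem_nhdsWithin] with t h1
    have h1 : 0 < t := h1
    subst h
    rw [zero_add, if_pos rfl]
    rcases lt_trichotomy b 0 with hb | rfl | hb
    · rw [Real.sign_of_neg hb, Real.sign_of_neg (mul_neg_of_pos_of_neg h1 hb)]
    · simp
    · rw [Real.sign_of_pos hb, Real.sign_of_pos (mul_pos h1 hb)]
  · filter_upwards [ht.eventually (lt_mem_nhds h)] with t h1
    rw [if_neg h.ne', Real.sign_of_pos h1, Real.sign_of_pos h]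

open Classical in
/-- The value of `posRows W (u + t w)` for all small `t > 0`. -/
def posRowsDir {n k : ℕ} (W : Matrix (Fin n) (Fin k) ℝ) (u w : E k) :
    Matrix (Fin n) (Fin k) ℝ :=
  Matrix.diagonal (fun i => if 0 < Matrix.toEuclideanLin W u i ∨
    Matrix.toEuclideanLin W u i = 0 ∧ 0 < Matrix.toEuclideanLin W w i then (1 : ℝ) else 0) * W

open Classical in
/-- The value of `signRows A (u + t w)` for all small `t > 0`. -/
def signRowsDir {m n : ℕ} (A : Matrix (Fin m) (Fin n) ℝ) (u w : E n) :
    Matrix (Fin m) (Fin n) ℝ :=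
  Matrix.diagonal (fun i => if Matrix.toEuclideanLin A u i = 0 then
    Real.sign (Matrix.toEuclideanLin A w i) else Real.sign (Matrix.toEuclideanLin A u i)) * A

theorem eventually_posRows_eq {n k : ℕ} (W : Matrix (Fin n) (Fin k) ℝ) (u w : E k) :
    ∀ᶠ t in 𝓝[>] (0 : ℝ), posRows W (u + t • w) = posRowsDir W u w := by
  have h : ∀ᶠ t in 𝓝[>] (0 : ℝ), ∀ i, (0 < Matrix.toEuclideanLin W u i +
      t * Matrix.toEuclideanLin W w i ↔ 0 < Matrix.toEuclideanLin W u i ∨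
        Matrix.toEuclideanLin W u i = 0 ∧ 0 < Matrix.toEuclideanLin W w i) :=
    eventually_all.2 fun i => eventually_pos_add_mul_iff _ _
  filter_upwards [h] with t ht
  unfold posRows posRowsDir
  congr 2
  ext i
  rw [map_add, map_smul, PiLp.add_apply, PiLp.smul_apply, smul_eq_mul]
  simp only [ht i]

theorem eventually_signRows_eq {m n : ℕ} (A : Matrix (Fin m) (Fin n) ℝ) (u w : E n) :
    ∀ᶠ t in 𝓝[>] (0 : ℝ), signRows A (u + t • w) = signRowsDir A u w := by
  have h : ∀ᶠ t in 𝓝[>] (0 : ℝ), ∀ i, Real.sign (Matrix.toEuclideanLin A u i +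
      t * Matrix.toEuclideanLin A w i) = if Matrix.toEuclideanLin A u i = 0 then
        Real.sign (Matrix.toEuclideanLin A w i) else Real.sign (Matrix.toEuclideanLin A u i) :=
    eventually_all.2 fun i => eventually_sign_add_mul_eq _ _
  filter_upwards [h] with t ht
  unfold signRows signRowsDir
  congr 2
  ext i
  rw [map_add, map_smul, PiLp.add_apply, PiLp.smul_apply, smul_eq_mul]
  simp only [ht i]

/-- The rows whose activation is decided by `w` annihilate `u`, so the tie-breaking does not matter.
-/
theorem posRowsDir_apply_self {n k : ℕ} (W : Matrix (Fin n) (Fin k) ℝ) (u w : E k) :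
    Matrix.toEuclideanLin (posRowsDir W u w) u = relu (Matrix.toEuclideanLin W u) := by
  ext i
  rw [posRowsDir, toEuclideanLin_diagonal_mul_apply]
  simp only [relu]
  rcases lt_trichotomy (Matrix.toEuclideanLin W u i) 0 with h | h | h
  · rw [if_neg (by rintro (h2 | ⟨h2, -⟩) <;> linarith), max_eq_right h.le, zero_mul]
  · simp [h]
  · rw [if_pos (Or.inl h), max_eq_left h.le, one_mul]

theorem signRowsDir_apply_self {m n : ℕ} (A : Matrix (Fin m) (Fin n) ℝ) (u w : E n) :
    Matrix.toEuclideanLin (signRowsDir A u w) u = absVec (Matrix.toEuclideanLin A u) := by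
  ext i
  rw [signRowsDir, toEuclideanLin_diagonal_mul_apply]
  simp only [absVec]
  split_ifs with h
  · simp [h]
  · exact sign_mul_eq_abs _

/-- The linear map that agrees with `gen W i` on `x + t v` for all small `t > 0`. -/
def genDir {n : ℕ → ℕ} (W : ∀ i, Matrix (Fin (n (i + 1))) (Fin (n i)) ℝ) (x v : E (n 0)) :
    ∀ i : ℕ, E (n 0) →ₗ[ℝ] E (n i)
  | 0 => LinearMap.id
  | i + 1 => Matrix.toEuclideanLin (posRowsDir (W i) (gen W i x) (genDir W x v i v)) ∘ₗ
      genDir W x v i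

section genDir

variable {n : ℕ → ℕ} (W : ∀ i, Matrix (Fin (n (i + 1))) (Fin (n i)) ℝ) (x v : E (n 0))

theorem genDir_succ_apply (i : ℕ) (u : E (n 0)) :
    genDir W x v (i + 1) u =
      Matrix.toEuclideanLin (posRowsDir (W i) (gen W i x) (genDir W x v i v))
        (genDir W x v i u) := rfl

theorem genDir_apply_self (i : ℕ) : genDir W x v i x = gen W i x := by
  induction i with
  | zero => rfl
  | succ i ih => rw [genDir_succ_apply, ih, posRowsDir_apply_self, gen]

theorem eventually_gen_eq (i : ℕ) :
    ∀ᶠ t in 𝓝[>] (0 : ℝ), gen W i (x + t • v) = gen W i x + t • genDir W x v i v := by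
  induction i with
  | zero => exact Eventually.of_forall fun t => rfl
  | succ i ih =>
    filter_upwards [ih, eventually_posRows_eq (W i) (gen W i x) (genDir W x v i v)] with t h1 h2
    rw [gen_succ_eq_posRows, h1, h2, map_add, map_smul, posRowsDir_apply_self,
      genDir_succ_apply, gen]

end genDir

/-! ### Consequences of the weight distribution condition -/

theorem swapMap_apply_right {k : ℕ} {x y : E k} (hx : x ≠ 0) (hy : y ≠ 0) :
    swapMap x y y = (‖y‖ / ‖x‖) • x := by
  have h : y = ‖y‖ • hat y := by simp [hat, smul_smul, norm_ne_zero_iff.mpr hy]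
  calc swapMap x y y = swapMap x y (‖y‖ • hat y) := by rw [← h]
    _ = _ := by rw [map_smul, swapMap_hat_right hx hy, hat, smul_smul, div_eq_mul_inv]

theorem inner_Q_right {k : ℕ} {x y : E k} (hx : x ≠ 0) (hy : y ≠ 0) (v : E k) :
    inner ℝ (Q x y y) v = (π - angle x y) / (2 * π) * inner ℝ y v +
      sin (angle x y) / (2 * π) * (‖y‖ / ‖x‖) * inner ℝ x v := by
  simp only [Q, add_apply, smul_apply,
    ContinuousLinearMap.id_apply, swapMap_apply_right hx hy, inner_add_left, real_inner_smul_left]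
  ring

theorem inner_Q_self {k : ℕ} {x : E k} (hx : x ≠ 0) (u v : E k) :
    inner ℝ (Q x x u) v = 1 / 2 * inner ℝ u v := by
  have h := pi_ne_zero
  simp only [Q, add_apply, smul_apply, ContinuousLinearMap.id_apply, inner_add_left,
    real_inner_smul_left, angle_self hx, sin_zero, zero_div, zero_mul, add_zero, sub_zero]
  field_simp

theorem WDC.abs_inner_sub_le {n k : ℕ} {W : Matrix (Fin n) (Fin k) ℝ} {ε : ℝ} (h : WDC W ε)
    {x y : E k} (hx : x ≠ 0) (hy : y ≠ 0) (u v : E k) :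
    |inner ℝ (Matrix.toEuclideanLin (posRows W y) u) (Matrix.toEuclideanLin (posRows W x) v) -
      inner ℝ (Q x y u) v| ≤ ε * ‖u‖ * ‖v‖ := by
  rw [← inner_toEuclideanCLM_transpose_mul, ← inner_sub_left, ← sub_apply]
  refine (abs_real_inner_le_norm _ _).trans ?_
  gcongr
  exact (ContinuousLinearMap.le_opNorm _ _).trans (by gcongr; exact h x y hx hy)

theorem tendsto_angle_add_smul {V : Type*} [NormedAddCommGroup V] [InnerProductSpace ℝ V]
    {x z : V} (w : V) (hx : x ≠ 0) (hz : z ≠ 0) :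
    Tendsto (fun t : ℝ => angle (x + t • w) z) (𝓝[>] 0) (𝓝 (angle x z)) := by
  have h1 := norm_ne_zero_iff.2 hx
  have h2 := norm_ne_zero_iff.2 hz
  have h : ContinuousAt (fun y : V => angle y z) x :=
    continuous_arccos.continuousAt.comp
      (ContinuousAt.div (by fun_prop) (by fun_prop) (mul_ne_zero h1 h2))
  exact h.tendsto.comp (tendsto_add_smul_nhdsGT_zero x w)

theorem eventually_add_smul_ne_zero {k : ℕ} {x : E k} (w : E k) (hx : x ≠ 0) :
    ∀ᶠ t in 𝓝[>] (0 : ℝ), x + t • w ≠ 0 :=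
  (tendsto_add_smul_nhdsGT_zero x w).eventually (isOpen_ne.mem_nhds hx)

section

variable {n k : ℕ} {W : Matrix (Fin n) (Fin k) ℝ} {ε : ℝ}

/-- The frozen pattern at `x` is the true pattern at `x + t w` for some small `t > 0`. As `Q y y`
acts as half the identity for every non-zero `y`, one such `t` is enough. -/
theorem WDC.abs_inner_posRowsDir_self_sub_le (h : WDC W ε) {x : E k} (w : E k) (hx : x ≠ 0)
    (u v : E k) :
    |inner ℝ (Matrix.toEuclideanLin (posRowsDir W x w) u)
        (Matrix.toEuclideanLin (posRowsDir W x w) v) - 1 / 2 * inner ℝ u v| ≤ ε * ‖u‖ * ‖v‖ := by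
  obtain ⟨t, h1, h2⟩ :=
    ((eventually_posRows_eq W x w).and (eventually_add_smul_ne_zero w hx)).exists
  rw [← h1, ← inner_Q_self h2]
  exact h.abs_inner_sub_le h2 h2 u v

/-- Here `Q (x + t w) z` does depend on `t`, so the bound is obtained by letting `t → 0⁺`; the angle
is continuous at non-zero vectors. -/
theorem WDC.abs_inner_posRowsDir_sub_le (h : WDC W ε) {x z : E k} (w : E k) (hx : x ≠ 0)
    (hz : z ≠ 0) (v : E k) :
    |inner ℝ (Matrix.toEuclideanLin (posRows W z) z)
        (Matrix.toEuclideanLin (posRowsDir W x w) v) -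
      ((π - angle x z) / (2 * π) * inner ℝ z v +
        sin (angle x z) / (2 * π) * (‖z‖ / ‖x‖) * inner ℝ x v)| ≤ ε * ‖z‖ * ‖v‖ := by
  have hang := tendsto_angle_add_smul w hx hz
  have hlim := tendsto_add_smul_nhdsGT_zero x w
  have hsin : Tendsto (fun t : ℝ => sin (angle (x + t • w) z)) (𝓝[>] 0) (𝓝 (sin (angle x z))) :=
    (continuous_sin.tendsto _).comp hang
  have hT : Tendsto (fun t : ℝ => |inner ℝ (Matrix.toEuclideanLin (posRows W z) z)
        (Matrix.toEuclideanLin (posRowsDir W x w) v) -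
      ((π - angle (x + t • w) z) / (2 * π) * inner ℝ z v +
        sin (angle (x + t • w) z) / (2 * π) * (‖z‖ / ‖x + t • w‖) * inner ℝ (x + t • w) v)|)
      (𝓝[>] 0) (𝓝 |inner ℝ (Matrix.toEuclideanLin (posRows W z) z)
        (Matrix.toEuclideanLin (posRowsDir W x w) v) -
      ((π - angle x z) / (2 * π) * inner ℝ z v +
        sin (angle x z) / (2 * π) * (‖z‖ / ‖x‖) * inner ℝ x v)|) := by
    refine (tendsto_const_nhds.sub (Tendsto.add ?_ ?_)).abs
    · exact ((tendsto_const_nhds.sub hang).div_const _).mul_const _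
    · refine ((hsin.div_const _).mul ?_).mul (hlim.inner tendsto_const_nhds)
      exact tendsto_const_nhds.div hlim.norm (norm_ne_zero_iff.2 hx)
  refine le_of_tendsto hT ?_
  filter_upwards [eventually_posRows_eq W x w, eventually_add_smul_ne_zero w hx] with t h1 h2
  rw [← h1, ← inner_Q_right h2 hz]
  exact h.abs_inner_sub_le h2 hz z v

end

/-! ### One-sided derivatives of the risk under the RRCP. -/

theorem hasOneSidedDeriv_of_eventually_eq {k m : ℕ} {f : E k → ℝ} {x v : E k} {a b : E m}
    (h0 : f x = 1 / 2 * ‖a‖ ^ 2)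
    (h : ∀ᶠ t in 𝓝[>] (0 : ℝ), f (x + t • v) = 1 / 2 * ‖a + t • b‖ ^ 2) :
    HasOneSidedDeriv f x v (inner ℝ a b) := by
  have hlim : Tendsto (fun t : ℝ => inner ℝ a b + t * (1 / 2 * ‖b‖ ^ 2)) (𝓝[>] 0)
      (𝓝 (inner ℝ a b)) :=
    tendsto_add_smul_nhdsGT_zero (inner ℝ a b) (1 / 2 * ‖b‖ ^ 2)
  refine hlim.congr' ?_
  filter_upwards [h, self_mem_nhdsWithin] with t h1 ht
  have ht : t ≠ 0 := (mem_Ioi.1 ht).ne'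
  rw [h1, h0, norm_add_sq_real, real_inner_smul_right, norm_smul, mul_pow, norm_eq_abs, sq_abs]
  field_simp
  ring

theorem inner_Phi_right {n : ℕ} {z w : E n} (hz : z ≠ 0) (hw : w ≠ 0) (v : E n) :
    inner ℝ (Phi z w w) v = (π - 2 * angle z w) / π * inner ℝ w v +
      2 * sin (angle z w) / π * (‖w‖ / ‖z‖) * inner ℝ z v := by
  simp only [Phi, add_apply, smul_apply, ContinuousLinearMap.id_apply,
    swapMap_apply_right hz hw, inner_add_left, real_inner_smul_left]
  ring

theorem inner_Phi_self {n : ℕ} {z : E n} (hz : z ≠ 0) (u v : E n) :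
    inner ℝ (Phi z z u) v = inner ℝ u v := by
  have h := pi_ne_zero
  simp only [Phi, add_apply, smul_apply, ContinuousLinearMap.id_apply, inner_add_left,
    real_inner_smul_left, angle_self hz, sin_zero, mul_zero, zero_div, zero_mul, add_zero,
    sub_zero, div_self h, one_mul]

theorem inner_Phi_right_left {n : ℕ} {z w : E n} (hz : z ≠ 0) (hw : w ≠ 0) :
    inner ℝ (Phi z w w) z = phaseFactor (angle z w) * (‖z‖ * ‖w‖) := by
  have h := norm_ne_zero_iff.2 hz
  rw [inner_Phi_right hz hw, real_inner_self_eq_norm_sq, real_inner_comm,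
    ← cos_angle_mul_norm_mul_norm, phaseFactor]
  field_simp

section

variable {n : ℕ → ℕ} {m d : ℕ} {W : ∀ i, Matrix (Fin (n (i + 1))) (Fin (n i)) ℝ}
  {A : Matrix (Fin m) (Fin (n d)) ℝ} {ε : ℝ}

theorem RRCP.abs_inner_signRows_sub_le (hA : RRCP (gen W d) A ε) {x y : E (n 0)} (hx : x ≠ 0)
    (hy : y ≠ 0) (x₁ x₂ x₃ x₄ : E (n 0)) :
    |inner ℝ (Matrix.toEuclideanLin (signRows A (gen W d y)) (gen W d x₁ - gen W d x₂))
        (Matrix.toEuclideanLin (signRows A (gen W d x)) (gen W d x₃ - gen W d x₄)) -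
      inner ℝ (Phi (gen W d x) (gen W d y) (gen W d x₁ - gen W d x₂))
        (gen W d x₃ - gen W d x₄)| ≤
      7 * ε * ‖gen W d x₁ - gen W d x₂‖ * ‖gen W d x₃ - gen W d x₄‖ := by
  rw [← inner_toEuclideanCLM_transpose_mul, ← inner_sub_left, ← sub_apply]
  exact hA x y hx hy x₁ x₂ x₃ x₄

/-- The concentration property, tested against a one-sided derivative of the network. -/
theorem RRCP.eventually_abs_inner_signRowsDir_sub_le (hA : RRCP (gen W d) A ε) {x : E (n 0)}
    (hx : x ≠ 0) (v y : E (n 0)) :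
    ∀ᶠ t in 𝓝[>] (0 : ℝ), ∀ y', y' ≠ 0 →
    |inner ℝ (Matrix.toEuclideanLin (signRows A (gen W d y')) (gen W d y))
        (Matrix.toEuclideanLin (signRowsDir A (gen W d x) (genDir W x v d v))
          (genDir W x v d v)) -
      inner ℝ (Phi (gen W d x + t • genDir W x v d v) (gen W d y') (gen W d y))
        (genDir W x v d v)| ≤ 7 * ε * ‖gen W d y‖ * ‖genDir W x v d v‖ := by
  filter_upwards [eventually_gen_eq W x v d, eventually_add_smul_ne_zero v hx,
    eventually_signRows_eq A (gen W d x) (genDir W x v d v), self_mem_nhdsWithin]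
    with t h1 h2 h3 ht y' hy'
  have ht : 0 < t := ht
  -- The difference `G (x + t v) - G x` equals `t L v` exactly, so the range-restricted property may
  -- be divided by `t`. The other difference is `G y - G 0 = G y`.
  have h := hA.abs_inner_signRows_sub_le h2 hy' y 0 (x + t • v) x
  rw [gen_zero_right, sub_zero, h1, add_sub_cancel_left, h3, map_smul, real_inner_smul_right,
    real_inner_smul_right, ← mul_sub, abs_mul, abs_of_pos ht, norm_smul, norm_eq_abs,
    abs_of_pos ht] at h
  refine le_of_mul_le_mul_left ?_ ht
  linarith

/-- Taking `y' = x + t v` makes both sign patterns equal, and `Phi z z` acts as the identity, so no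
limit is needed. -/
theorem RRCP.abs_inner_signRowsDir_self_sub_le (hA : RRCP (gen W d) A ε)
    (hG : ∀ x, x ≠ 0 → gen W d x ≠ 0) {x : E (n 0)} (hx : x ≠ 0) (v : E (n 0)) :
    |inner ℝ (Matrix.toEuclideanLin (signRowsDir A (gen W d x) (genDir W x v d v)) (gen W d x))
        (Matrix.toEuclideanLin (signRowsDir A (gen W d x) (genDir W x v d v))
          (genDir W x v d v)) - inner ℝ (gen W d x) (genDir W x v d v)| ≤
      7 * ε * ‖gen W d x‖ * ‖genDir W x v d v‖ := by
  obtain ⟨t, h1, h2, h3, h4⟩ := ((hA.eventually_abs_inner_signRowsDir_sub_le hx v x).and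
    ((eventually_gen_eq W x v d).and ((eventually_add_smul_ne_zero v hx).and
      (eventually_signRows_eq A (gen W d x) (genDir W x v d v))))).exists
  have h := h1 _ h3
  have h5 := hG _ h3
  rw [h2] at h h5
  rwa [h4, inner_Phi_self h5] at h

theorem RRCP.abs_inner_signRowsDir_sub_le (hA : RRCP (gen W d) A ε)
    (hG : ∀ x, x ≠ 0 → gen W d x ≠ 0) {x y : E (n 0)} (hx : x ≠ 0) (hy : y ≠ 0) (v : E (n 0)) :
    |inner ℝ (Matrix.toEuclideanLin (signRows A (gen W d y)) (gen W d y))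
        (Matrix.toEuclideanLin (signRowsDir A (gen W d x) (genDir W x v d v))
          (genDir W x v d v)) -
      inner ℝ (Phi (gen W d x) (gen W d y) (gen W d y)) (genDir W x v d v)| ≤
      7 * ε * ‖gen W d y‖ * ‖genDir W x v d v‖ := by
  set p := gen W d x
  set z := gen W d y
  set q := genDir W x v d v
  have hp : p ≠ 0 := hG x hx
  have hz : z ≠ 0 := hG y hy
  have hang := tendsto_angle_add_smul q hp hz
  have hlim := tendsto_add_smul_nhdsGT_zero p q
  have hsin : Tendsto (fun t : ℝ => sin (angle (p + t • q) z)) (𝓝[>] 0) (𝓝 (sin (angle p z))) :=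
    (continuous_sin.tendsto _).comp hang
  have hT : Tendsto (fun t : ℝ => (π - 2 * angle (p + t • q) z) / π * inner ℝ z q +
      2 * sin (angle (p + t • q) z) / π * (‖z‖ / ‖p + t • q‖) * inner ℝ (p + t • q) q)
      (𝓝[>] 0) (𝓝 (inner ℝ (Phi p z z) q)) := by
    rw [inner_Phi_right hp hz]
    refine Tendsto.add ?_ ?_
    · exact ((tendsto_const_nhds.sub (hang.const_mul 2)).div_const _).mul_const _
    · refine (((hsin.const_mul 2).div_const _).mul ?_).mul (hlim.inner tendsto_const_nhds)
      exact tendsto_const_nhds.div hlim.norm (norm_ne_zero_iff.2 hp)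
  refine le_of_tendsto (tendsto_const_nhds.sub hT).abs ?_
  filter_upwards [hA.eventually_abs_inner_signRowsDir_sub_le hx v y,
    eventually_add_smul_ne_zero q hp] with t h1 h2
  rw [← inner_Phi_right h2 hz]
  exact h1 y hy

theorem hasOneSidedDeriv_risk (x₀ x v : E (n 0)) :
    HasOneSidedDeriv (risk (gen W d) A x₀) x v
      (inner ℝ (Matrix.toEuclideanLin (signRowsDir A (gen W d x) (genDir W x v d v)) (gen W d x) -
          Matrix.toEuclideanLin (signRows A (gen W d x₀)) (gen W d x₀))
        (Matrix.toEuclideanLin (signRowsDir A (gen W d x) (genDir W x v d v))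
          (genDir W x v d v))) := by
  refine hasOneSidedDeriv_of_eventually_eq ?_ ?_
  · rw [signRowsDir_apply_self, ← absVec_eq_signRows, risk]
  · filter_upwards [eventually_gen_eq W x v d,
      eventually_signRows_eq A (gen W d x) (genDir W x v d v)] with t h1 h2
    rw [risk, h1, absVec_eq_signRows, h2, map_add, map_smul, ← absVec_eq_signRows,
      add_sub_right_comm]

/-- The one-sided derivatives of the risk at a non-zero point exist, and are controlled by the
expected activation patterns. -/
theorem exists_hasOneSidedDeriv_risk_le (hA : RRCP (gen W d) A ε)
    (hG : ∀ x, x ≠ 0 → gen W d x ≠ 0) {x x₀ : E (n 0)} (hx : x ≠ 0) (hx₀ : x₀ ≠ 0)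
    (v : E (n 0)) :
    ∃ D, HasOneSidedDeriv (risk (gen W d) A x₀) x v D ∧
      D ≤ inner ℝ (gen W d x) (genDir W x v d v) -
          inner ℝ (Phi (gen W d x) (gen W d x₀) (gen W d x₀)) (genDir W x v d v) +
        7 * ε * (‖gen W d x‖ + ‖gen W d x₀‖) * ‖genDir W x v d v‖ := by
  refine ⟨_, hasOneSidedDeriv_risk x₀ x v, ?_⟩
  have h1 := (abs_le.1 (hA.abs_inner_signRowsDir_self_sub_le hG hx v)).2
  have h2 := (abs_le.1 (hA.abs_inner_signRowsDir_sub_le hG hx hx₀ v)).1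
  rw [inner_sub_left]
  linarith

/-- At the origin the risk decreases in every direction. -/
theorem exists_hasOneSidedDeriv_risk_zero_neg (hA : RRCP (gen W d) A ε) (hε : 7 * ε < 2 / π)
    (hG : ∀ x, x ≠ 0 → gen W d x ≠ 0) {x x₀ : E (n 0)} (hx : x ≠ 0) (hx₀ : x₀ ≠ 0) :
    ∃ D, D < 0 ∧ HasOneSidedDeriv (risk (gen W d) A x₀) 0 x D := by
  have hp := hG x hx
  have hz := hG x₀ hx₀
  have h := hA.abs_inner_signRows_sub_le hx hx₀ x₀ 0 x 0
  rw [gen_zero_right, sub_zero, sub_zero, inner_Phi_right_left hp hz] at h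
  refine ⟨_, ?_, hasOneSidedDeriv_of_eventually_eq
    (a := -absVec (Matrix.toEuclideanLin A (gen W d x₀)))
    (b := absVec (Matrix.toEuclideanLin A (gen W d x))) ?_ ?_⟩
  · rw [absVec_eq_signRows, absVec_eq_signRows, inner_neg_left, neg_lt_zero]
    have h1 := (abs_le.1 h).1
    have h2 := two_div_pi_le_phaseFactor
      ⟨angle_nonneg (gen W d x) (gen W d x₀), angle_le_pi (gen W d x) (gen W d x₀)⟩
    have h3 : 0 < ‖gen W d x‖ * ‖gen W d x₀‖ :=
      mul_pos (norm_pos_iff.2 hp) (norm_pos_iff.2 hz)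
    have h4 := mul_lt_mul_of_pos_right (hε.trans_le h2) h3
    linarith
  · have h0 : absVec (Matrix.toEuclideanLin A (gen W d 0)) = 0 := by
      ext i
      simp [absVec, gen_zero_right]
    rw [risk, h0, zero_sub]
  · filter_upwards [self_mem_nhdsWithin] with t ht
    have ht : 0 ≤ t := (mem_Ioi.1 ht).le
    have h0 : absVec (Matrix.toEuclideanLin A (t • gen W d x)) =
        t • absVec (Matrix.toEuclideanLin A (gen W d x)) := by
      ext i
      simp [absVec, abs_mul, abs_of_nonneg ht]
    rw [risk, zero_add, gen_smul W d x ht, h0, sub_eq_neg_add]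

end

/-! ### Propagation of norms, angles and inner products through the layers. -/

/-- Relative errors `2 ε` per step would compound; as long as `4 d ε ≤ 1` they keep `T i ≤ 2 T 0`,
so the drift stays linear in `i`. -/
theorem abs_sub_zero_le_of_abs_succ_sub_le {T : ℕ → ℝ} {ε : ℝ} {d : ℕ} (hε : 0 ≤ ε)
    (hd : 4 * (d * ε) ≤ 1) (hT : 0 ≤ T 0) (h : ∀ i < d, |T (i + 1) - T i| ≤ 2 * ε * T i) :
    ∀ i ≤ d, |T i - T 0| ≤ 4 * i * ε * T 0 := by
  intro i
  induction i with
  | zero => intro _; simp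
  | succ i ih =>
    intro hi
    have h1 := ih (by omega)
    have h2 := h i (by omega)
    have hid : (i : ℝ) * ε ≤ d * ε := by
      gcongr
      omega
    have h3 : T i ≤ 2 * T 0 := by
      have := (abs_le.1 h1).2
      nlinarith
    have h4 := abs_sub_le (T (i + 1)) (T i) (T 0)
    have h5 : 2 * ε * T i ≤ 2 * ε * (2 * T 0) := by gcongr
    push_cast
    linarith

/-- Components of `x - c x₀` along and across `x`. -/
theorem norm_sub_smul_le {k : ℕ} (x x₀ : E k) (c : ℝ) :
    ‖x - c • x₀‖ ≤ |‖x‖ - c * (‖x₀‖ * cos (angle x x₀))| + |c| * (‖x₀‖ * sin (angle x x₀)) := by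
  have hs := sin_angle_nonneg x x₀
  have hr : 0 ≤ |c| * (‖x₀‖ * sin (angle x x₀)) := by positivity
  refine (abs_le_of_sq_le_sq' ?_ (by positivity)).2
  have h1 : ‖x - c • x₀‖ ^ 2 = (‖x‖ - c * (‖x₀‖ * cos (angle x x₀))) ^ 2 +
      (|c| * (‖x₀‖ * sin (angle x x₀))) ^ 2 := by
    rw [norm_sub_sq_real, real_inner_smul_right, ← cos_angle_mul_norm_mul_norm, norm_smul,
      norm_eq_abs]
    have := sin_sq_add_cos_sq (angle x x₀)
    simp only [mul_pow, sq_abs]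
    linear_combination (-(c ^ 2 * ‖x₀‖ ^ 2)) * this
  rw [h1, ← sq_abs (‖x‖ - c * (‖x₀‖ * cos (angle x x₀)))]
  nlinarith [mul_nonneg (abs_nonneg (‖x‖ - c * (‖x₀‖ * cos (angle x x₀)))) hr]

section WDC

variable {n k : ℕ} {W : Matrix (Fin n) (Fin k) ℝ} {ε : ℝ}

theorem WDC.abs_norm_sq_posRowsDir_sub_le (h : WDC W ε) {x : E k} (w : E k) (hx : x ≠ 0)
    (u : E k) :
    |2 * ‖Matrix.toEuclideanLin (posRowsDir W x w) u‖ ^ 2 - ‖u‖ ^ 2| ≤ 2 * ε * ‖u‖ ^ 2 := by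
  have h1 := h.abs_inner_posRowsDir_self_sub_le w hx u u
  rw [real_inner_self_eq_norm_sq, real_inner_self_eq_norm_sq] at h1
  rw [abs_le] at *
  constructor <;> linarith [h1.1, h1.2]

theorem WDC.abs_norm_sq_relu_sub_le (h : WDC W ε) {x : E k} (hx : x ≠ 0) :
    |2 * ‖relu (Matrix.toEuclideanLin W x)‖ ^ 2 - ‖x‖ ^ 2| ≤ 2 * ε * ‖x‖ ^ 2 := by
  have := h.abs_norm_sq_posRowsDir_sub_le x hx x
  rwa [posRowsDir_apply_self] at this

theorem WDC.relu_ne_zero (h : WDC W ε) (hε : ε < 1 / 2) {x : E k} (hx : x ≠ 0) :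
    relu (Matrix.toEuclideanLin W x) ≠ 0 := by
  intro h0
  have h1 := h.abs_norm_sq_relu_sub_le hx
  rw [h0] at h1
  have h2 : 0 < ‖x‖ ^ 2 := by positivity
  have h3 := (abs_le.1 h1).1
  norm_num at h3
  nlinarith

/-- A layer acts on angles like `g`, up to an error of order `ε` in the cosine. -/
theorem WDC.abs_cos_angle_relu_sub_le (h : WDC W ε) (hε₀ : 0 ≤ ε) (hε : ε < 1 / 2) {x z : E k}
    (hx : x ≠ 0) (hz : z ≠ 0) :
    |cos (angle (relu (Matrix.toEuclideanLin W x)) (relu (Matrix.toEuclideanLin W z))) -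
      cosStep (angle x z)| ≤ 4 * ε := by
  have h1 := h.abs_inner_posRowsDir_sub_le x hx hz x
  rw [posRowsDir_apply_self, ← relu_eq_posRows, real_inner_self_eq_norm_sq] at h1
  have hx1 := h.abs_norm_sq_relu_sub_le hx
  have hz1 := h.abs_norm_sq_relu_sub_le hz
  set X := relu (Matrix.toEuclideanLin W x)
  set Z := relu (Matrix.toEuclideanLin W z)
  have hX : 0 < ‖x‖ := norm_pos_iff.2 hx
  have hZ : 0 < ‖z‖ := norm_pos_iff.2 hz
  rw [real_inner_comm, ← cos_angle_mul_norm_mul_norm X Z, real_inner_comm,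
    ← cos_angle_mul_norm_mul_norm x z] at h1
  set c := cos (angle X Z)
  have hc : |c| ≤ 1 := abs_cos_le_one _
  have e1 : (π - angle x z) / (2 * π) * (cos (angle x z) * (‖x‖ * ‖z‖)) +
      sin (angle x z) / (2 * π) * (‖z‖ / ‖x‖) * ‖x‖ ^ 2 =
      1 / 2 * cosStep (angle x z) * (‖x‖ * ‖z‖) := by
    unfold cosStep
    field_simp
  rw [e1] at h1
  set s := cosStep (angle x z)
  set P := ‖X‖ * ‖Z‖
  have hxz : 0 < ‖x‖ * ‖z‖ := mul_pos hX hZ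
  have hP : |2 * P - ‖x‖ * ‖z‖| ≤ 2 * ε * (‖x‖ * ‖z‖) := by
    rw [abs_le] at *
    have hP0 : 0 ≤ P := by positivity
    constructor
    · have h2 : (1 - 2 * ε) * (‖x‖ * ‖z‖) ≤ 2 * P := by
        refine (abs_le_of_sq_le_sq' ?_ (by positivity)).2
        calc ((1 - 2 * ε) * (‖x‖ * ‖z‖)) ^ 2
            = ((1 - 2 * ε) * ‖x‖ ^ 2) * ((1 - 2 * ε) * ‖z‖ ^ 2) := by ring
          _ ≤ (2 * ‖X‖ ^ 2) * (2 * ‖Z‖ ^ 2) := by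
            have : 0 ≤ 1 - 2 * ε := by linarith
            apply mul_le_mul _ _ (by positivity) (by positivity) <;>
              linarith [hx1.1, hz1.1]
          _ = (2 * P) ^ 2 := by ring
      linarith
    · have h2 : 2 * P ≤ (1 + 2 * ε) * (‖x‖ * ‖z‖) := by
        refine (abs_le_of_sq_le_sq' ?_ (by positivity)).2
        calc (2 * P) ^ 2 = (2 * ‖X‖ ^ 2) * (2 * ‖Z‖ ^ 2) := by ring
          _ ≤ ((1 + 2 * ε) * ‖x‖ ^ 2) * ((1 + 2 * ε) * ‖z‖ ^ 2) := by
            apply mul_le_mul _ _ (by positivity) (by positivity) <;>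
              linarith [hx1.2, hz1.2]
          _ = _ := by ring
      linarith
  have h3 : |c * (2 * P - ‖x‖ * ‖z‖)| ≤ 2 * ε * (‖x‖ * ‖z‖) := by
    rw [abs_mul]
    calc |c| * |2 * P - ‖x‖ * ‖z‖| ≤ 1 * (2 * ε * (‖x‖ * ‖z‖)) := by gcongr
      _ = _ := one_mul _
  have h4 : |c - s| * (‖x‖ * ‖z‖) ≤ 4 * ε * (‖x‖ * ‖z‖) := by
    rw [← abs_of_pos hxz, ← abs_mul, abs_of_pos hxz]
    rw [abs_le] at *
    constructor <;> nlinarith [h1.1, h1.2, h3.1, h3.2]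
  exact le_of_mul_le_mul_right h4 hxz

end WDC

section network

variable {n : ℕ → ℕ} {d : ℕ} {W : ∀ i, Matrix (Fin (n (i + 1))) (Fin (n i)) ℝ} {ε : ℝ}

theorem gen_ne_zero (hW : ∀ i < d, WDC (W i) ε) (hε : ε < 1 / 2) {x : E (n 0)} (hx : x ≠ 0) :
    ∀ i ≤ d, gen W i x ≠ 0 := by
  intro i
  induction i with
  | zero => intro _; exact hx
  | succ i ih => intro hi; exact (hW i (by omega)).relu_ne_zero hε (ih (by omega))

theorem abs_two_pow_mul_norm_genDir_sub_le (hW : ∀ i < d, WDC (W i) ε) (hε : 0 ≤ ε)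
    (hε' : ε < 1 / 2) (hd : 4 * (d * ε) ≤ 1) {x : E (n 0)} (hx : x ≠ 0) (v u : E (n 0)) :
    ∀ i ≤ d, |2 ^ i * ‖genDir W x v i u‖ ^ 2 - ‖u‖ ^ 2| ≤ 4 * i * ε * ‖u‖ ^ 2 := by
  have h := abs_sub_zero_le_of_abs_succ_sub_le (T := fun i => 2 ^ i * ‖genDir W x v i u‖ ^ 2)
    hε hd (by positivity) fun i hi => ?_
  · simpa [genDir] using h
  · have h1 := (hW i hi).abs_norm_sq_posRowsDir_sub_le (genDir W x v i v)
      (gen_ne_zero hW hε' hx i hi.le) (genDir W x v i u)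
    rw [← genDir_succ_apply] at h1
    have h2 : (0 : ℝ) < 2 ^ i := by positivity
    calc |2 ^ (i + 1) * ‖genDir W x v (i + 1) u‖ ^ 2 - 2 ^ i * ‖genDir W x v i u‖ ^ 2|
        = 2 ^ i * |2 * ‖genDir W x v (i + 1) u‖ ^ 2 - ‖genDir W x v i u‖ ^ 2| := by
          rw [← abs_of_pos h2, ← abs_mul, abs_of_pos h2]
          congr 1
          ring
      _ ≤ 2 ^ i * (2 * ε * ‖genDir W x v i u‖ ^ 2) := by gcongr
      _ = _ := by ring

theorem abs_two_pow_mul_norm_gen_sub_le (hW : ∀ i < d, WDC (W i) ε) (hε : 0 ≤ ε)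
    (hε' : ε < 1 / 2) (hd : 4 * (d * ε) ≤ 1) {x : E (n 0)} (hx : x ≠ 0) :
    ∀ i ≤ d, |2 ^ i * ‖gen W i x‖ ^ 2 - ‖x‖ ^ 2| ≤ 4 * i * ε * ‖x‖ ^ 2 := by
  intro i hi
  have := abs_two_pow_mul_norm_genDir_sub_le hW hε hε' hd hx x x i hi
  rwa [genDir_apply_self] at this

theorem two_pow_mul_norm_genDir_le (hW : ∀ i < d, WDC (W i) ε) (hε : 0 ≤ ε)
    (hε' : ε < 1 / 2) (hd : 4 * (d * ε) ≤ 1) {x : E (n 0)} (hx : x ≠ 0) (v u : E (n 0))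
    {i : ℕ} (hi : i ≤ d) : 2 ^ i * ‖genDir W x v i u‖ ^ 2 ≤ 2 * ‖u‖ ^ 2 := by
  have h := (abs_le.1 (abs_two_pow_mul_norm_genDir_sub_le hW hε hε' hd hx v u i hi)).2
  have h1 : 4 * (i : ℝ) * ε ≤ 1 := by
    have : (i : ℝ) * ε ≤ d * ε := by gcongr
    linarith
  nlinarith [sq_nonneg ‖u‖]

theorem two_pow_mul_norm_gen_mul_norm_genDir_le (hW : ∀ i < d, WDC (W i) ε) (hε : 0 ≤ ε)
    (hε' : ε < 1 / 2) (hd : 4 * (d * ε) ≤ 1) {x y : E (n 0)} (hx : x ≠ 0) (hy : y ≠ 0)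
    (v u : E (n 0)) {i : ℕ} (hi : i ≤ d) :
    2 ^ i * (‖gen W i y‖ * ‖genDir W x v i u‖) ≤ 2 * (‖y‖ * ‖u‖) := by
  have h1 := two_pow_mul_norm_genDir_le hW hε hε' hd hx v u hi
  have h2 := two_pow_mul_norm_genDir_le hW hε hε' hd hy y y hi
  rw [genDir_apply_self] at h2
  refine (abs_le_of_sq_le_sq' ?_ (by positivity)).2
  calc (2 ^ i * (‖gen W i y‖ * ‖genDir W x v i u‖)) ^ 2
      = (2 ^ i * ‖gen W i y‖ ^ 2) * (2 ^ i * ‖genDir W x v i u‖ ^ 2) := by ring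
    _ ≤ (2 * ‖y‖ ^ 2) * (2 * ‖u‖ ^ 2) := by gcongr
    _ = _ := by ring

theorem norm_gen_mul_norm_le (hW : ∀ i < d, WDC (W i) ε) (hε : 0 ≤ ε)
    (hε' : ε < 1 / 2) (hd : 8 * (d * ε) ≤ 1) {x y : E (n 0)} (hx : x ≠ 0) (hy : y ≠ 0)
    {i : ℕ} (hi : i ≤ d) : ‖gen W i y‖ * ‖x‖ ≤ 2 * (‖gen W i x‖ * ‖y‖) := by
  have hidε : (i : ℝ) * ε ≤ d * ε := by gcongr
  have h1 := (abs_le.1 (abs_two_pow_mul_norm_gen_sub_le hW hε hε' (by linarith) hx i hi)).1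
  have h2 := (abs_le.1 (abs_two_pow_mul_norm_gen_sub_le hW hε hε' (by linarith) hy i hi)).2
  have h3 : ‖x‖ ^ 2 ≤ 2 * (2 ^ i * ‖gen W i x‖ ^ 2) := by nlinarith [sq_nonneg ‖x‖]
  have h4 : 2 ^ i * ‖gen W i y‖ ^ 2 ≤ 2 * ‖y‖ ^ 2 := by nlinarith [sq_nonneg ‖y‖]
  have h5 : (0 : ℝ) < 2 ^ i := by positivity
  refine (abs_le_of_sq_le_sq' (le_of_mul_le_mul_left ?_ h5) (by positivity)).2
  calc 2 ^ i * (‖gen W i y‖ * ‖x‖) ^ 2 = (2 ^ i * ‖gen W i y‖ ^ 2) * ‖x‖ ^ 2 := by ring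
    _ ≤ (2 * ‖y‖ ^ 2) * (2 * (2 ^ i * ‖gen W i x‖ ^ 2)) := by gcongr
    _ = _ := by ring

theorem abs_cos_angle_gen_succ_sub_le (hW : ∀ i < d, WDC (W i) ε) (hε : 0 ≤ ε)
    (hε' : ε < 1 / 2) {x z : E (n 0)} (hx : x ≠ 0) (hz : z ≠ 0) :
    ∀ i < d, |cos (angle (gen W (i + 1) x) (gen W (i + 1) z)) -
      cosStep (angle (gen W i x) (gen W i z))| ≤ 4 * ε := fun i hi =>
  (hW i hi).abs_cos_angle_relu_sub_le hε hε' (gen_ne_zero hW hε' hx i hi.le)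
    (gen_ne_zero hW hε' hz i hi.le)

/-- `⟨G x, L u⟩` for the one-sided derivative `L` of `G` at `x`. -/
theorem abs_two_pow_mul_inner_gen_genDir_sub_le (hW : ∀ i < d, WDC (W i) ε) (hε : 0 ≤ ε)
    (hε' : ε < 1 / 2) (hd : 4 * (d * ε) ≤ 1) {x : E (n 0)} (hx : x ≠ 0) (v u : E (n 0)) :
    ∀ i ≤ d, |2 ^ i * inner ℝ (gen W i x) (genDir W x v i u) - inner ℝ x u| ≤
      4 * i * ε * (‖x‖ * ‖u‖) := by
  intro i
  induction i with
  | zero => intro _; simp [gen, genDir]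
  | succ i ih =>
    intro hi
    have h1 := ih (by omega)
    have h2 := (hW i (by omega)).abs_inner_posRowsDir_self_sub_le (genDir W x v i v)
      (gen_ne_zero hW hε' hx i (by omega)) (gen W i x) (genDir W x v i u)
    rw [← genDir_succ_apply, posRowsDir_apply_self, ← gen] at h2
    have h3 := two_pow_mul_norm_gen_mul_norm_genDir_le hW hε hε' hd hx hx v u
      (show i ≤ d by omega)
    have h4 : (0 : ℝ) < 2 ^ i := by positivity
    have h5 := mul_le_mul_of_nonneg_left h2 h4.le
    rw [← abs_of_pos h4, ← abs_mul, abs_of_pos h4] at h5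
    have h6 := mul_le_mul_of_nonneg_left h3 hε
    push_cast
    rw [pow_succ]
    rw [abs_le] at *
    constructor <;> linarith [h1.1, h1.2, h5.1, h5.2]

/-- `⟨G z, L e⟩` for the one-sided derivative `L` of `G` at `x`, along some `e` orthogonal to
`x`. -/
theorem le_two_pow_mul_inner_gen_genDir (hW : ∀ i < d, WDC (W i) ε) (hε : 0 ≤ ε)
    (hε' : ε < 1 / 2) (hd : 8 * (d * ε) ≤ 1) {x z : E (n 0)} (hx : x ≠ 0) (hz : z ≠ 0)
    {e : E (n 0)} (he : inner ℝ x e = 0) (v : E (n 0)) :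
    ∀ i ≤ d, (∏ j ∈ Finset.range i, (π - angle (gen W j x) (gen W j z)) / π) * inner ℝ z e -
        8 * (i * d) * ε * (‖z‖ * ‖e‖) ≤ 2 ^ i * inner ℝ (gen W i z) (genDir W x v i e) := by
  intro i
  induction i with
  | zero => intro _; simp [gen, genDir]
  | succ i ih =>
    intro hi
    have hid : i ≤ d := by omega
    have h1 := ih hid
    have hxi := gen_ne_zero hW hε' hx i hid
    have hzi := gen_ne_zero hW hε' hz i hid
    have h2 := (hW i (by omega)).abs_inner_posRowsDir_sub_le (genDir W x v i v) hxi hzi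
      (genDir W x v i e)
    rw [← genDir_succ_apply, ← gen_succ_eq_posRows] at h2
    have hb := abs_two_pow_mul_inner_gen_genDir_sub_le hW hε hε' (by linarith) hx v e i hid
    rw [he, sub_zero] at hb
    have h3 := two_pow_mul_norm_gen_mul_norm_genDir_le hW hε hε' (by linarith) hx hz v e hid
    have h4 := norm_gen_mul_norm_le hW hε hε' hd hx hz hid
    have hθ0 := angle_nonneg (gen W i x) (gen W i z)
    have hθ1 := angle_le_pi (gen W i x) (gen W i z)
    set θ := angle (gen W i x) (gen W i z)
    set a := inner ℝ (gen W i z) (genDir W x v i e)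
    set b := inner ℝ (gen W i x) (genDir W x v i e)
    set r := ‖gen W i z‖ / ‖gen W i x‖ with hr
    have hr0 : 0 ≤ r := by positivity
    have hrx : r * ‖x‖ ≤ 2 * ‖z‖ := by
      rw [hr, div_mul_eq_mul_div, div_le_iff₀ (norm_pos_iff.2 hxi)]
      linarith
    -- The reflection part of `Q` only contributes `⟨gen W i x, L e⟩`, which is `O(ε)` because `e ⊥
    -- x`.
    have hcross : |sin θ / π * r * (2 ^ i * b)| ≤ 8 * i * ε * (‖z‖ * ‖e‖) := by
      have hs : |sin θ / π| ≤ 1 := by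
        rw [abs_div, abs_of_pos pi_pos, div_le_one pi_pos]
        exact (abs_sin_le_one θ).trans (by linarith [pi_gt_three])
      calc |sin θ / π * r * (2 ^ i * b)| = |sin θ / π| * r * |2 ^ i * b| := by
            rw [abs_mul, abs_mul, abs_of_nonneg hr0]
        _ ≤ 1 * r * (4 * i * ε * (‖x‖ * ‖e‖)) := by gcongr
        _ = 4 * i * ε * ((r * ‖x‖) * ‖e‖) := by ring
        _ ≤ 4 * i * ε * ((2 * ‖z‖) * ‖e‖) := by gcongr
        _ = _ := by ring
    have h5 : (0 : ℝ) < 2 ^ (i + 1) := by positivity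
    have h6 := mul_le_mul_of_nonneg_left (abs_le.1 h2).1 h5.le
    have h7 : 2 ^ (i + 1) * ((π - θ) / (2 * π) * a + sin θ / (2 * π) * r * b) =
        (π - θ) / π * (2 ^ i * a) + sin θ / π * r * (2 ^ i * b) := by
      rw [pow_succ]
      field_simp
    have h8 : 2 ^ (i + 1) * (ε * ‖gen W i z‖ * ‖genDir W x v i e‖) ≤ 4 * ε * (‖z‖ * ‖e‖) := by
      have := mul_le_mul_of_nonneg_left h3 (by positivity : 0 ≤ 2 * ε)
      rw [pow_succ]
      linarith
    have hp0 : 0 ≤ (π - θ) / π := div_nonneg (by linarith) pi_pos.le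
    have hp1 : (π - θ) / π ≤ 1 := by
      rw [div_le_one pi_pos]
      linarith
    have h9 := mul_le_mul_of_nonneg_left h1 hp0
    have h10 : 0 ≤ 8 * (i * d) * ε * (‖z‖ * ‖e‖) := by positivity
    have h11 := mul_le_mul_of_nonneg_right hp1 h10
    -- A layer adds `4 ε` from the WDC and `8 i ε` from the cross term, together at most `8 d ε`.
    have h12 : 8 * ((i : ℝ) + 1) * ε * (‖z‖ * ‖e‖) ≤ 8 * d * ε * (‖z‖ * ‖e‖) := by
      gcongr
      exact_mod_cast hi
    rw [Finset.prod_range_succ]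
    have h13 := (abs_le.1 hcross).1
    have h14 : 0 ≤ ε * (‖z‖ * ‖e‖) := by positivity
    push_cast
    linarith

end network

/-! ### Points without descent directions. -/

theorem angle_mem {k : ℕ} (x y : E k) : angle x y ∈ Icc 0 π := ⟨angle_nonneg x y, angle_le_pi x y⟩

section network

variable {n : ℕ → ℕ} {d m : ℕ} {W : ∀ i, Matrix (Fin (n (i + 1))) (Fin (n i)) ℝ}
  {A : Matrix (Fin m) (Fin (n d)) ℝ} {ε : ℝ}

/-- If neither `x` nor `-x` is a descent direction, then `‖G x‖` has nearly its optimal value. -/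
theorem abs_norm_gen_sub_le_of_not_descent (hA : RRCP (gen W d) A ε)
    (hG : ∀ x, x ≠ 0 → gen W d x ≠ 0) {x x₀ : E (n 0)} (hx : x ≠ 0) (hx₀ : x₀ ≠ 0)
    (hf : ∀ v D, HasOneSidedDeriv (risk (gen W d) A x₀) x v D → 0 ≤ D) :
    |‖gen W d x‖ - phaseFactor (angle (gen W d x) (gen W d x₀)) * ‖gen W d x₀‖| ≤
      7 * ε * (‖gen W d x‖ + ‖gen W d x₀‖) := by
  have hp := norm_pos_iff.2 (hG x hx)
  have key : ∀ v, 0 ≤ inner ℝ (gen W d x) (genDir W x v d v) -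
      inner ℝ (Phi (gen W d x) (gen W d x₀) (gen W d x₀)) (genDir W x v d v) +
        7 * ε * (‖gen W d x‖ + ‖gen W d x₀‖) * ‖genDir W x v d v‖ := by
    intro v
    obtain ⟨D, hD, hle⟩ := exists_hasOneSidedDeriv_risk_le hA hG hx hx₀ v
    exact (hf v D hD).trans hle
  -- Moving along `x` or `-x` gives `L v = G x` or `-G x`, hence two opposite inequalities.
  have h1 := key x
  have h2 := key (-x)
  rw [map_neg, norm_neg, inner_neg_right, inner_neg_right] at h2
  rw [genDir_apply_self, real_inner_self_eq_norm_sq, inner_Phi_right_left (hG x hx) (hG x₀ hx₀)]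
    at h1 h2
  rw [abs_le]
  constructor
  · refine le_of_mul_le_mul_right ?_ hp
    linarith
  · refine le_of_mul_le_mul_right ?_ hp
    linarith

/-- The bound on squares becomes linear after factoring `p² - ‖x‖² = (p - ‖x‖)(p + ‖x‖)` and using
`p + ‖x‖ ≥ ‖x‖`. -/
theorem abs_sqrt_mul_norm_gen_sub_le (hW : ∀ i < d, WDC (W i) ε) (hε : 0 ≤ ε)
    (hε' : ε < 1 / 2) (hd : 4 * (d * ε) ≤ 1) {x : E (n 0)} (hx : x ≠ 0) :
    |√(2 ^ d) * ‖gen W d x‖ - ‖x‖| ≤ 4 * (d * ε) * ‖x‖ := by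
  have h := abs_two_pow_mul_norm_gen_sub_le hW hε hε' hd hx d le_rfl
  have hX : 0 < ‖x‖ := norm_pos_iff.2 hx
  have hs : 0 ≤ √(2 ^ d) * ‖gen W d x‖ := by positivity
  have e : 2 ^ d * ‖gen W d x‖ ^ 2 - ‖x‖ ^ 2 =
      (√(2 ^ d) * ‖gen W d x‖ - ‖x‖) * (√(2 ^ d) * ‖gen W d x‖ + ‖x‖) := by
    have : √((2 : ℝ) ^ d) ^ 2 = 2 ^ d := sq_sqrt (by positivity)
    linear_combination -‖gen W d x‖ ^ 2 * this
  rw [e, abs_mul, abs_of_nonneg (by linarith : 0 ≤ √(2 ^ d) * ‖gen W d x‖ + ‖x‖)] at h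
  refine le_of_mul_le_mul_right ?_ hX
  calc |√(2 ^ d) * ‖gen W d x‖ - ‖x‖| * ‖x‖
      ≤ |√(2 ^ d) * ‖gen W d x‖ - ‖x‖| * (√(2 ^ d) * ‖gen W d x‖ + ‖x‖) := by
        gcongr
        linarith
    _ ≤ _ := h
    _ = _ := by ring

/-- If neither `x` nor `-x` is a descent direction, then `‖x‖` has nearly its optimal value. -/
theorem abs_norm_sub_le_of_not_descent (hA : RRCP (gen W d) A ε) (hW : ∀ i < d, WDC (W i) ε)
    (hε : 0 ≤ ε) (hε' : ε < 1 / 2) (hd2 : 2 ≤ d) (hd : 100 * (d * ε) ≤ 1)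
    {x x₀ : E (n 0)} (hx : x ≠ 0) (hx₀ : x₀ ≠ 0)
    (hf : ∀ v D, HasOneSidedDeriv (risk (gen W d) A x₀) x v D → 0 ≤ D) :
    ‖x‖ ≤ 3 * ‖x₀‖ ∧ |‖x‖ - phaseFactor (angle (gen W d x) (gen W d x₀)) * ‖x₀‖| ≤
      48 * (d * ε) * ‖x₀‖ := by
  have h1 := abs_norm_gen_sub_le_of_not_descent hA
    (fun x hx => gen_ne_zero hW hε' hx d le_rfl) hx hx₀ hf
  have h2 := abs_sqrt_mul_norm_gen_sub_le hW hε hε' (by linarith) hx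
  have h3 := abs_sqrt_mul_norm_gen_sub_le hW hε hε' (by linarith) hx₀
  have hF0 : 0 ≤ phaseFactor (angle (gen W d x) (gen W d x₀)) :=
    (by positivity : 0 ≤ 2 / π).trans (two_div_pi_le_phaseFactor (angle_mem _ _))
  have hF2 := phaseFactor_le_two (angle_mem (gen W d x) (gen W d x₀))
  set F := phaseFactor (angle (gen W d x) (gen W d x₀))
  have hs : 0 < √((2 : ℝ) ^ d) := by positivity
  have h4 := mul_le_mul_of_nonneg_left h1 hs.le
  rw [← abs_of_pos hs, ← abs_mul, abs_of_pos hs] at h4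
  set s := √((2 : ℝ) ^ d)
  have hX : 0 < ‖x‖ := norm_pos_iff.2 hx
  have hX₀ : 0 < ‖x₀‖ := norm_pos_iff.2 hx₀
  set p := s * ‖gen W d x‖ with hp
  set z := s * ‖gen W d x₀‖ with hz
  have e1 : s * (‖gen W d x‖ - F * ‖gen W d x₀‖) = p - F * z := by
    rw [hp, hz]
    ring
  have e2 : s * (7 * ε * (‖gen W d x‖ + ‖gen W d x₀‖)) = 7 * ε * (p + z) := by
    rw [hp, hz]
    ring
  rw [e1, e2] at h4
  have hdε : 2 * ε ≤ d * ε := by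
    gcongr
    exact_mod_cast hd2
  set η := (d : ℝ) * ε
  have hη : 0 ≤ η := by linarith
  have h5 : |F * (z - ‖x₀‖)| ≤ 8 * η * ‖x₀‖ := by
    rw [abs_mul, abs_of_nonneg hF0]
    calc F * |z - ‖x₀‖| ≤ 2 * (4 * η * ‖x₀‖) := by gcongr
      _ = _ := by ring
  have hp2 : p ≤ 2 * ‖x‖ := by nlinarith [(abs_le.1 h2).2]
  have hz2 : z ≤ 2 * ‖x₀‖ := by nlinarith [(abs_le.1 h3).2]
  have h6 : 7 * ε * (p + z) ≤ 7 * η * (‖x‖ + ‖x₀‖) := by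
    calc 7 * ε * (p + z) ≤ 7 * ε * (2 * ‖x‖ + 2 * ‖x₀‖) := by gcongr
      _ = 7 * (2 * ε) * (‖x‖ + ‖x₀‖) := by ring
      _ ≤ _ := by gcongr
  have h7 : |‖x‖ - F * ‖x₀‖| ≤ η * (11 * ‖x‖ + 15 * ‖x₀‖) := by
    rw [abs_le] at *
    constructor <;> linarith [h2.1, h2.2, h4.1, h4.2, h5.1, h5.2]
  have h8 : ‖x‖ ≤ 3 * ‖x₀‖ := by
    have := (abs_le.1 h7).2
    nlinarith
  refine ⟨h8, h7.trans ?_⟩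
  -- The constant is `11 * 3 + 15 = 48`.
  nlinarith

/-- If the component of `x₀` orthogonal to `x` is not a descent direction, then `x` is nearly
parallel to `x₀`. -/
theorem prod_mul_norm_le_of_not_descent (hA : RRCP (gen W d) A ε) (hW : ∀ i < d, WDC (W i) ε)
    (hε : 0 ≤ ε) (hε' : ε < 1 / 2) (hd2 : 2 ≤ d) (hd : 100 * (d * ε) ≤ 1)
    {x x₀ e : E (n 0)} (hx : x ≠ 0) (hx₀ : x₀ ≠ 0) (hle : ‖x‖ ≤ 3 * ‖x₀‖)
    (he : inner ℝ x e = 0) (he₀ : inner ℝ x₀ e = ‖e‖ ^ 2)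
    (hα : angle (gen W d x) (gen W d x₀) ≤ π / 2)
    (hf : ∀ v D, HasOneSidedDeriv (risk (gen W d) A x₀) x v D → 0 ≤ D) :
    (π - 2 * angle (gen W d x) (gen W d x₀)) / π *
      (∏ j ∈ Finset.range d, (π - angle (gen W j x) (gen W j x₀)) / π) * ‖e‖ ≤
      32 * (d : ℝ) ^ 2 * ε * ‖x₀‖ := by
  rcases eq_or_ne e 0 with rfl | hne
  · rw [norm_zero, mul_zero]
    positivity
  have hG := fun x (hx : x ≠ 0) => gen_ne_zero hW hε' hx d le_rfl
  obtain ⟨D, hD, hDle⟩ := exists_hasOneSidedDeriv_risk_le hA hG hx hx₀ e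
  have h0 := (hf e D hD).trans hDle
  rw [inner_Phi_right (hG x hx) (hG x₀ hx₀)] at h0
  have ha := le_two_pow_mul_inner_gen_genDir hW hε hε' (by linarith) hx hx₀ he e d le_rfl
  have hb := abs_two_pow_mul_inner_gen_genDir_sub_le hW hε hε' (by linarith) hx e e d le_rfl
  have h1 := two_pow_mul_norm_gen_mul_norm_genDir_le hW hε hε' (by linarith) hx hx e e
    (le_refl d)
  have h2 := two_pow_mul_norm_gen_mul_norm_genDir_le hW hε hε' (by linarith) hx hx₀ e e
    (le_refl d)
  have h3 := norm_gen_mul_norm_le hW hε hε' (by linarith) hx hx₀ (le_refl d)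
  rw [he, sub_zero] at hb
  rw [he₀] at ha
  have hP := norm_pos_iff.2 (hG x hx)
  have hθ0 := angle_nonneg (gen W d x) (gen W d x₀)
  set θ := angle (gen W d x) (gen W d x₀)
  set q := genDir W x e d e
  set a := inner ℝ (gen W d x₀) q
  set b := inner ℝ (gen W d x) q
  set prd := ∏ j ∈ Finset.range d, (π - angle (gen W j x) (gen W j x₀)) / π
  set r := ‖gen W d x₀‖ / ‖gen W d x‖ with hr
  have hr0 : 0 ≤ r := by positivity
  have hrx : r * ‖x‖ ≤ 2 * ‖x₀‖ := by
    rw [hr, div_mul_eq_mul_div, div_le_iff₀ hP]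
    linarith
  have hcross : |2 * sin θ / π * r * (2 ^ d * b)| ≤ 8 * (d * ε) * (‖x₀‖ * ‖e‖) := by
    have hs : |2 * sin θ / π| ≤ 1 := by
      rw [abs_div, abs_of_pos pi_pos, div_le_one pi_pos, abs_mul, abs_two]
      linarith [pi_gt_three, abs_sin_le_one θ]
    calc |2 * sin θ / π * r * (2 ^ d * b)| = |2 * sin θ / π| * r * |2 ^ d * b| := by
          rw [abs_mul, abs_mul, abs_of_nonneg hr0]
      _ ≤ 1 * r * (4 * d * ε * (‖x‖ * ‖e‖)) := by gcongr
      _ = 4 * d * ε * ((r * ‖x‖) * ‖e‖) := by ring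
      _ ≤ 4 * d * ε * ((2 * ‖x₀‖) * ‖e‖) := by gcongr
      _ = _ := by ring
  set α := (π - 2 * θ) / π with hαdef
  have hα0 : 0 ≤ α := div_nonneg (by linarith) pi_pos.le
  have hα1 : α ≤ 1 := by
    rw [hαdef, div_le_one pi_pos]
    linarith
  have h4 := mul_nonneg (by positivity : (0 : ℝ) ≤ 2 ^ d) h0
  have h5 := mul_le_mul_of_nonneg_left ha hα0
  have h6 := mul_le_mul_of_nonneg_right hα1
    (by positivity : 0 ≤ 8 * ((d : ℝ) * d) * ε * (‖x₀‖ * ‖e‖))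
  have hu : 0 ≤ ε * (‖x₀‖ * ‖e‖) := by positivity
  have h7 : ‖x‖ * ‖e‖ ≤ 3 * (‖x₀‖ * ‖e‖) := by nlinarith [norm_nonneg e]
  have h8 : 4 * d * ε * (‖x‖ * ‖e‖) ≤ 12 * d * (ε * (‖x₀‖ * ‖e‖)) := by
    have := mul_le_mul_of_nonneg_left h7 (by positivity : 0 ≤ 4 * (d : ℝ) * ε)
    linarith
  have h9 : 2 ^ d * (7 * ε * (‖gen W d x‖ + ‖gen W d x₀‖) * ‖q‖) ≤
      56 * (ε * (‖x₀‖ * ‖e‖)) := by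
    have := mul_le_mul_of_nonneg_left (add_le_add h1 h2) (by positivity : 0 ≤ 7 * ε)
    have := mul_le_mul_of_nonneg_left h7 (by positivity : 0 ≤ 14 * ε)
    linarith
  have hd2' : (2 : ℝ) ≤ d := by exact_mod_cast hd2
  have h10 : 56 * (ε * (‖x₀‖ * ‖e‖)) ≤ 28 * d * (ε * (‖x₀‖ * ‖e‖)) := by
    gcongr
    linarith
  -- The terms linear in `d` are `8 d` (cross term), `12 d` (`⟨G x, L e⟩`) and `28 d` (RRCP). With
  -- `d ≥ 2` they fit into `24 d²`, and `8 d²` comes from `⟨G x₀, L e⟩`.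
  have h11 : 48 * d * (ε * (‖x₀‖ * ‖e‖)) ≤ 24 * (d : ℝ) ^ 2 * (ε * (‖x₀‖ * ‖e‖)) :=
    mul_le_mul_of_nonneg_right (by nlinarith) hu
  refine le_of_mul_le_mul_right ?_ (norm_pos_iff.2 hne)
  have h12 := (abs_le.1 hb).2
  have h13 := (abs_le.1 hcross).1
  linarith

/-- After two layers, angles are bounded away from `π / 2`. -/
theorem quarter_le_cos_angle_gen (hW : ∀ i < d, WDC (W i) ε) (hε : 0 ≤ ε)
    (hε' : 200 * ε ≤ 1) (hd2 : 2 ≤ d) {x z : E (n 0)} (hx : x ≠ 0) (hz : z ≠ 0) :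
    1 / 4 ≤ cos (angle (gen W d x) (gen W d z)) := by
  have hstep := abs_cos_angle_gen_succ_sub_le hW hε (by linarith) hx hz
  obtain ⟨j, rfl⟩ : ∃ j, d = j + 2 := ⟨d - 2, by omega⟩
  have h1 := (abs_le.1 (hstep j (by omega))).1
  have h2 := (abs_le.1 (hstep (j + 1) (by omega))).1
  have h3 := (cosStep_mem (angle_mem (gen W j x) (gen W j z))).1
  have hπ2 : π / 2 ∈ Icc 0 π := ⟨by positivity, by linarith [pi_pos]⟩
  have hm := angle_mem (gen W (j + 1) x) (gen W (j + 1) z)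
  set θ := angle (gen W (j + 1) x) (gen W (j + 1) z)
  -- As `cosStep ≥ 0`, one layer gives `cos θ ≥ -4 ε`. The angle may exceed `π / 2` slightly, and
  -- the Lipschitz bound then compares with `cosStep (π / 2) = 1 / π`.
  have h4 : 1 / π - 4 * ε ≤ cosStep θ := by
    rw [← cosStep_pi_div_two]
    rcases le_total θ (π / 2) with h | h
    · linarith [antitoneOn_cosStep hm hπ2 h]
    · have h5 := (abs_le.1 (abs_cosStep_sub_le hm hπ2)).1
      rw [cos_pi_div_two, sub_zero, abs_of_nonpos
        (cos_nonpos_of_pi_div_two_le_of_le h (by linarith [hm.2]))] at h5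
      linarith
  have h5 : 0.3 ≤ 1 / π := by
    rw [le_div_iff₀ pi_pos]
    linarith [pi_lt_d2]
  linarith

/-- Points without descent directions are nearly parallel to `x₀`. -/
theorem pi_sub_angle_mul_sin_le_of_not_descent (hA : RRCP (gen W d) A ε)
    (hW : ∀ i < d, WDC (W i) ε) (hε : 0 ≤ ε) (hd2 : 2 ≤ d)
    (hsmall : 10 ^ 4 * ((d : ℝ) ^ 3 * ε) ≤ 1) {x x₀ : E (n 0)} (hx : x ≠ 0) (hx₀ : x₀ ≠ 0)
    (hle : ‖x‖ ≤ 3 * ‖x₀‖)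
    (hf : ∀ v D, HasOneSidedDeriv (risk (gen W d) A x₀) x v D → 0 ≤ D) :
    (π - angle x x₀) * sin (angle x x₀) ≤ 900 * ((d : ℝ) ^ 14 * ε) := by
  have hd2' : (2 : ℝ) ≤ d := by exact_mod_cast hd2
  have hdε : d * ε ≤ (d : ℝ) ^ 3 * ε := by
    gcongr
    exact le_self_pow₀ (by linarith) (by norm_num)
  have hε1 : ε ≤ d * ε := by nlinarith
  have hε' : ε < 1 / 2 := by linarith
  have hcos := quarter_le_cos_angle_gen hW hε (by linarith) hd2 hx hx₀
  have hθ : ∀ i, angle (gen W i x) (gen W i x₀) ∈ Icc 0 π := fun i => angle_mem _ _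
  have hα : 1 / 4 ≤ π / 2 - angle (gen W d x) (gen W d x₀) := by
    have h1 : angle (gen W d x) (gen W d x₀) ≤ π / 2 := by
      by_contra! h
      linarith [cos_nonpos_of_pi_div_two_le_of_le h.le (by linarith [(hθ d).2, pi_pos])]
    rw [← sin_pi_div_two_sub] at hcos
    exact hcos.trans (sin_le (by linarith))
  have hX : 0 < ‖x‖ := norm_pos_iff.2 hx
  have hX₀ : 0 < ‖x₀‖ := norm_pos_iff.2 hx₀
  set e : E (n 0) := x₀ - (inner ℝ x x₀ / ‖x‖ ^ 2) • x with he
  have hxe : inner ℝ x e = 0 := by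
    rw [he, inner_sub_right, real_inner_smul_right, real_inner_self_eq_norm_sq]
    field_simp
    ring
  have hx₀e : inner ℝ x₀ e = ‖e‖ ^ 2 := by
    have h1 : inner ℝ e e = inner ℝ x₀ e := by
      conv_lhs => rw [he, inner_sub_left, real_inner_smul_left, ← he, hxe, mul_zero, sub_zero]
    rw [← h1, real_inner_self_eq_norm_sq]
  have hnorm : ‖e‖ = ‖x₀‖ * sin (angle x x₀) := by
    have h1 : ‖e‖ ^ 2 = (‖x₀‖ * sin (angle x x₀)) ^ 2 := by
      rw [← hx₀e, he, inner_sub_right, real_inner_smul_right, real_inner_self_eq_norm_sq,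
        real_inner_comm x x₀, ← cos_angle_mul_norm_mul_norm x x₀, mul_pow, sin_sq]
      field_simp
    exact (pow_left_inj₀ (norm_nonneg _)
      (mul_nonneg hX₀.le (sin_angle_nonneg x x₀)) two_ne_zero).1 h1
  have h1 := prod_mul_norm_le_of_not_descent hA hW hε hε' hd2 (by linarith) hx hx₀ hle hxe hx₀e
    (by linarith) hf
  -- The bound required on `δ = 4 ε` follows from `d + 12 ≤ 7 d`.
  have hdecay := sin_half_le_of_cosStep_le (δ := 4 * ε) hθ (fun i hi => by
      linarith [(abs_le.1 (abs_cos_angle_gen_succ_sub_le hW hε hε' hx hx₀ i hi)).1]) (d := d) (by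
    have : ((d : ℝ) + 12) ^ 3 ≤ (7 * d) ^ 3 := by
      gcongr
      linarith
    nlinarith)
  have hprod := prod_one_sub_angle_ge hθ hdecay (d - 1) (by omega)
  rw [show d - 1 + 1 = d by omega, show ((d - 1 : ℕ) : ℝ) + 1 = d by
    exact_mod_cast (by omega : d - 1 + 1 = d)] at hprod
  have hα' : 1 / 7 ≤ (π - 2 * angle (gen W d x) (gen W d x₀)) / π := by
    rw [le_div_iff₀ pi_pos]
    linarith [pi_lt_d2]
  set θ₀ := angle x x₀ with hθ₀
  have h0 : angle (gen W 0 x) (gen W 0 x₀) = θ₀ := rfl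
  rw [h0] at hprod
  have hm : θ₀ ∈ Icc 0 π := angle_mem x x₀
  have hπθ : 0 ≤ π - θ₀ := by linarith [hm.2]
  have hs0 : 0 ≤ sin θ₀ := sin_nonneg_of_mem_Icc hm
  have h2 : 1 / 7 * ((π - θ₀) / π * (1 / (d : ℝ) ^ 12)) * (‖x₀‖ * sin θ₀) ≤
      32 * (d : ℝ) ^ 2 * ε * ‖x₀‖ := by
    rw [← hnorm]
    refine le_trans ?_ h1
    gcongr
  have h3 : (π - θ₀) * sin θ₀ = 7 * π * (d : ℝ) ^ 12 / ‖x₀‖ *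
      (1 / 7 * ((π - θ₀) / π * (1 / (d : ℝ) ^ 12)) * (‖x₀‖ * sin θ₀)) := by
    field_simp
  rw [h3]
  calc _ ≤ 7 * π * (d : ℝ) ^ 12 / ‖x₀‖ * (32 * (d : ℝ) ^ 2 * ε * ‖x₀‖) := by gcongr
    _ = 224 * π * ((d : ℝ) ^ 14 * ε) := by
      field_simp
      ring
    _ ≤ _ := by
      gcongr
      linarith [pi_le_four]

/-- Points without descent directions are close to `x₀` or to `-ρ_d x₀`. -/
theorem norm_sub_le_of_not_descent (hA : RRCP (gen W d) A ε)
    (hW : ∀ i < d, WDC (W i) ε) {τ : ℝ} (hτ : 0 ≤ τ) (hετ : ε = τ ^ 4) (hd2 : 2 ≤ d)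
    (hsmall : 1000 * (d : ℝ) ^ 8 * τ ≤ 1) {x x₀ : E (n 0)} (hx : x ≠ 0) (hx₀ : x₀ ≠ 0)
    (hf : ∀ v D, HasOneSidedDeriv (risk (gen W d) A x₀) x v D → 0 ≤ D) :
    ‖x - x₀‖ ≤ τ / 2 * ‖x₀‖ ∨ ‖x - (-rho d) • x₀‖ ≤ τ / 2 * ‖x₀‖ := by
  have hd2' : (2 : ℝ) ≤ d := by exact_mod_cast hd2
  have hd1 : (1 : ℝ) ≤ d := by linarith
  have hε : 0 ≤ ε := by
    rw [hετ]
    positivity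
  have hd7 : 1000 * ((d : ℝ) ^ 7 * τ) ≤ 1 := by
    have : (d : ℝ) ^ 7 * τ ≤ (d : ℝ) ^ 8 * τ := by
      gcongr
      norm_num
    linarith
  have hτ1 : 1000 * τ ≤ 1 := by
    have : 1 * τ ≤ (d : ℝ) ^ 7 * τ := by
      gcongr
      exact one_le_pow₀ hd1
    linarith
  set ν := (d : ℝ) ^ 7 * τ with hν
  have hν0 : 0 ≤ ν := by positivity
  -- Writing the angular error as a square prepares the square root taken near `θ = π`.
  have h14 : (d : ℝ) ^ 14 * ε = (ν * τ) ^ 2 := by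
    rw [hετ, hν]
    ring
  have hντ : ν * τ ≤ τ / 1000 := by nlinarith
  have hντ0 : 0 ≤ ν * τ := by positivity
  have h14' : (d : ℝ) ^ 14 * ε ≤ τ / 10 ^ 9 := by
    rw [h14]
    nlinarith
  have hpow : ∀ j ≤ 14, (d : ℝ) ^ j * ε ≤ (d : ℝ) ^ 14 * ε := fun j hj => by
    gcongr
  have hp1 := hpow 1 (by norm_num)
  have hp3 := hpow 3 (by norm_num)
  have hp0 := hpow 0 (by norm_num)
  rw [pow_one] at hp1
  rw [pow_zero, one_mul] at hp0
  have hε' : ε < 1 / 2 := by linarith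
  obtain ⟨hle, hrad⟩ :=
    abs_norm_sub_le_of_not_descent hA hW hε hε' hd2 (by linarith) hx hx₀ hf
  have hang := pi_sub_angle_mul_sin_le_of_not_descent hA hW hε hd2 (by linarith) hx hx₀ hle hf
  have hX₀ : 0 < ‖x₀‖ := norm_pos_iff.2 hx₀
  have hθ : ∀ i, angle (gen W i x) (gen W i x₀) ∈ Icc 0 π := fun i => angle_mem _ _
  have hstep := abs_cos_angle_gen_succ_sub_le hW hε hε' hx hx₀
  have horbit : ∀ ψ ∈ Icc 0 π, |cos (angle (gen W d x) (gen W d x₀)) - cos (g^[d] ψ)| ≤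
      |cos (angle x x₀) - cos ψ| + d * (4 * ε) := fun ψ hψ =>
    abs_cos_sub_cos_iterate_le hθ hstep hψ d le_rfl
  have hφ : ∀ ψ ∈ Icc 0 π, |phaseFactor (angle (gen W d x) (gen W d x₀)) -
      phaseFactor (g^[d] ψ)| ≤ |cos (angle x x₀) - cos ψ| + d * (4 * ε) := fun ψ hψ =>
    (abs_phaseFactor_sub_le (hθ d) (iterate_g_mem hψ d)).trans (horbit ψ hψ)
  set F := phaseFactor (angle (gen W d x) (gen W d x₀))
  have hm : angle x x₀ ∈ Icc 0 π := angle_mem x x₀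
  have hlaw := norm_sub_smul_le x x₀
  set θ := angle x x₀
  have hs0 : 0 ≤ sin θ := sin_nonneg_of_mem_Icc hm
  have hs1 := sin_le_one θ
  have hsc := sin_sq_add_cos_sq θ
  have hπ := pi_gt_three
  rcases le_total θ (π / 2) with h | h
  · left
    -- Here `π - θ ≥ π / 2 > 1`, so the angular estimate bounds `sin θ` without loss.
    have hsin : sin θ ≤ 900 * ((d : ℝ) ^ 14 * ε) := by nlinarith
    have hc0 : 0 ≤ cos θ := cos_nonneg_of_mem_Icc ⟨by linarith [hm.1], h⟩
    have hc1 := cos_le_one θ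
    -- Indeed `1 - cos θ ≤ 1 - cos² θ = sin² θ ≤ sin θ`.
    have hcos : 1 - cos θ ≤ sin θ := by nlinarith
    have hF := hφ 0 ⟨le_rfl, pi_pos.le⟩
    rw [Function.iterate_fixed g_zero, phaseFactor_zero, cos_zero,
      abs_of_nonpos (by linarith : cos θ - 1 ≤ 0)] at hF
    have h1 := hlaw 1
    rw [one_smul, one_mul, abs_one, one_mul] at h1
    refine h1.trans ?_
    have h2 : |‖x‖ - ‖x₀‖ * cos θ| ≤
        (48 * (d * ε) + (1 - cos θ + d * (4 * ε)) + (1 - cos θ)) * ‖x₀‖ := by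
      have e : ‖x‖ - ‖x₀‖ * cos θ =
          (‖x‖ - F * ‖x₀‖) + (F - 1) * ‖x₀‖ + (1 - cos θ) * ‖x₀‖ := by ring
      rw [e]
      refine (abs_add_three _ _ _).trans ?_
      rw [abs_mul, abs_mul, abs_of_pos hX₀, abs_of_nonneg (by linarith : 0 ≤ 1 - cos θ),
        add_mul, add_mul]
      gcongr
      linarith
    have h3 : 48 * (d * ε) + (1 - cos θ + d * (4 * ε)) + (1 - cos θ) + sin θ ≤ τ / 2 := by
      linarith
    have h4 := mul_le_mul_of_nonneg_right h3 hX₀.le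
    linarith
  · right
    -- Near `π` the factor `π - θ` degenerates; only `sin θ ≤ π - θ` is available, so the estimate
    -- bounds `sin² θ`, and `30 = √900`.
    have hsin : sin θ ≤ 30 * (ν * τ) := by
      have h1 : sin θ ≤ π - θ := by
        rw [← sin_pi_sub]
        exact sin_le (by linarith [hm.2])
      rw [h14] at hang
      refine (abs_le_of_sq_le_sq' ?_ (by positivity)).2
      nlinarith
    have hc0 : cos θ ≤ 0 := cos_nonpos_of_pi_div_two_le_of_le h (by linarith [hm.2])
    have hc1 := neg_one_le_cos θ
    have hcos : 1 + cos θ ≤ sin θ := by nlinarith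
    have hF := hφ π ⟨pi_pos.le, le_rfl⟩
    have hρ : phaseFactor (g^[d] π) = rho d := (rho_eq_phaseFactor (by omega)).symm
    rw [hρ, cos_pi, sub_neg_eq_add, abs_of_nonneg (by linarith : 0 ≤ cos θ + 1)] at hF
    have hρ0 := rho_pos (d := d) (by omega)
    have hρ2 : rho d ≤ 2 := by
      rw [rho_eq_phaseFactor (by omega)]
      exact phaseFactor_le_two (breve_mem d)
    refine (hlaw (-rho d)).trans ?_
    rw [abs_neg, abs_of_pos hρ0]
    have h2 : |‖x‖ - -rho d * (‖x₀‖ * cos θ)| ≤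
        (48 * (d * ε) + (cos θ + 1 + d * (4 * ε)) + 2 * (1 + cos θ)) * ‖x₀‖ := by
      have e : ‖x‖ - -rho d * (‖x₀‖ * cos θ) =
          (‖x‖ - F * ‖x₀‖) + (F - rho d) * ‖x₀‖ + rho d * (1 + cos θ) * ‖x₀‖ := by ring
      rw [e]
      refine (abs_add_three _ _ _).trans ?_
      have hc2 : 0 ≤ 1 + cos θ := by linarith
      rw [abs_mul, abs_mul, abs_of_pos hX₀, abs_of_nonneg (mul_nonneg hρ0.le hc2),
        add_mul, add_mul]
      gcongr
    have h3 : 48 * (d * ε) + (cos θ + 1 + d * (4 * ε)) + 2 * (1 + cos θ) + 2 * sin θ ≤ τ / 2 := by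
      linarith
    have h4 := mul_le_mul_of_nonneg_right h3 hX₀.le
    have h5 : rho d * (‖x₀‖ * sin θ) ≤ 2 * (‖x₀‖ * sin θ) := by gcongr
    linarith

end network

end DeepPR

end

theorem theorem3 :
    (∀ d : ℕ, 2 ≤ d → 0 < DeepPR.rho d) ∧
    Filter.Tendsto DeepPR.rho Filter.atTop (nhds 1) ∧
    ∃ K₁ K₂ : ℝ, 0 < K₁ ∧ 0 < K₂ ∧
      ∀ (d : ℕ) (n : ℕ → ℕ) (m : ℕ)
        (W : ∀ i : ℕ, Matrix (Fin (n (i + 1))) (Fin (n i)) ℝ)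
        (A : Matrix (Fin m) (Fin (n d)) ℝ) (ε : ℝ),
        2 ≤ d → 0 < ε → K₁ * (d : ℝ) ^ 8 * ε ^ (1 / 4 : ℝ) ≤ 1 →
        (∀ i : ℕ, i < d → DeepPR.WDC (W i) ε) →
        DeepPR.RRCP (DeepPR.gen W d) A ε →
        ∀ x₀ : DeepPR.E (n 0), x₀ ≠ 0 →
          (∀ x : DeepPR.E (n 0), x ≠ 0 →
            x ∉ Metric.ball x₀ (K₂ * (d : ℝ) ^ 3 * ε ^ (1 / 4 : ℝ) * ‖x₀‖) ∪
                Metric.ball (-(DeepPR.rho d • x₀)) (K₂ * (d : ℝ) ^ 14 * ε ^ (1 / 4 : ℝ) * ‖x₀‖) →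
            ∃ v : DeepPR.E (n 0), ∃ D : ℝ, D < 0 ∧
              DeepPR.HasOneSidedDeriv (DeepPR.risk (DeepPR.gen W d) A x₀) x (-v) D) ∧
          (∀ x : DeepPR.E (n 0), x ≠ 0 → ∃ D : ℝ, D < 0 ∧
            DeepPR.HasOneSidedDeriv (DeepPR.risk (DeepPR.gen W d) A x₀) 0 x D) := by
  refine ⟨fun d hd => DeepPR.rho_pos (by omega), DeepPR.tendsto_rho, 1000, 1, by norm_num,
    one_pos, ?_⟩
  intro d n m W A ε hd hε hsmall hW hA x₀ hx₀
  have hτ : 0 < ε ^ (1 / 4 : ℝ) := Real.rpow_pos_of_pos hε _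
  have hετ : ε = (ε ^ (1 / 4 : ℝ)) ^ 4 := by
    rw [← Real.rpow_natCast, ← Real.rpow_mul hε.le]
    norm_num
  set τ := ε ^ (1 / 4 : ℝ)
  have hd1 : (1 : ℝ) ≤ d := by exact_mod_cast (by omega : 1 ≤ d)
  have hpow : ∀ j : ℕ, (1 : ℝ) ≤ (d : ℝ) ^ j := fun j => one_le_pow₀ hd1
  have hτ1 : 1000 * τ ≤ 1 := by
    have : 1 * τ ≤ (d : ℝ) ^ 8 * τ := by
      gcongr
      exact hpow 8
    linarith
  have hε1 : 1000 * ε ≤ 1 := by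
    have : τ ^ 4 ≤ τ := pow_le_of_le_one hτ.le (by linarith) (by norm_num)
    linarith
  have hG : ∀ x, x ≠ 0 → DeepPR.gen W d x ≠ 0 := fun x hx =>
    DeepPR.gen_ne_zero hW (by linarith) hx d le_rfl
  refine ⟨fun x hx hball => ?_, fun x hx =>
    DeepPR.exists_hasOneSidedDeriv_risk_zero_neg hA ?_ hG hx hx₀⟩
  · by_contra! hcon
    have hX₀ : 0 < ‖x₀‖ := norm_pos_iff.2 hx₀
    -- Radius `τ / 2 * ‖x₀‖` works for both balls; the powers `d ^ 3` and `d ^ 14` are slack because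
    -- `d ≥ 1`.
    have hlt : ∀ j : ℕ, τ / 2 * ‖x₀‖ < 1 * (d : ℝ) ^ j * τ * ‖x₀‖ := fun j => by
      gcongr
      nlinarith [hpow j]
    refine hball ?_
    rcases DeepPR.norm_sub_le_of_not_descent hA hW hτ.le hετ hd hsmall hx hx₀ fun v D hD =>
      not_lt.1 fun hneg => hcon (-v) D hneg (by rwa [neg_neg]) with h | h
    · left
      rw [Metric.mem_ball, dist_eq_norm]
      exact h.trans_lt (hlt 3)
    · right
      rw [Metric.mem_ball, dist_eq_norm, ← neg_smul]
      exact h.trans_lt (hlt 14)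
  · rw [lt_div_iff₀ Real.pi_pos]
    nlinarith [Real.pi_le_four]
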